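/- Let $d\ge 1$, let $K\subseteq\mathbb R^d$ be measurable with positive Lebesgue measure, and let $\rho\colon K\to(0,\infty)$ be Lebesgue integrable. Let $\pi$ be the probability measure on $K$ with $\pi(A)=\int_A\rho(x)\,dx\big/\int_K\rho(x)\,dx$, and let $L_2(\pi)$ carry the inner product $\langle f,g\rangle_\pi=\int_K fg\,d\pi$. Let $\sigma$ be the uniform distribution on the Euclidean unit sphere $S^{d-1}$. For $t\ge 0$, $x\in K$, $\theta\in S^{d-1}$ put $K(t)=\{y\in K:\rho(y)>t\}$, $L_t(x,\theta)=\{x+s\theta: s\in\mathbb R\}\cap K(t)$ and $L(x,\theta)=L_0(x,\theta)$. Let $|\cdot|$ and $dz$ on lines denote one-dimensional Lebesgue measure and $\mathrm{vol}_d$ Lebesgue measure on $\mathbb R^d$. Let $q\colon\mathbb R^d\to[0,\infty)$ be a probability density that is rotationally invariant, i.e. $q(r\theta_1)=q(r\theta_2)$ for all $r\in\mathbb R$, $\theta_1,\theta_2\in S^{d-1}$. Consider the following transition kernels on $K$ (defined for $\pi$-almost every $x$): - lazy random walk Metropolis: for measurable $A\subseteq K$ with $x\notin A$, $M(x,A)=\frac12\int_A\min\{1,\rho(y)/\rho(x)\}\,q(y-x)\,dy$,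 and $M(x,\{x\})=1-M(x,K\setminus\{x\})$; - hybrid slice sampler based on hit-and-run: $U(x,A)=\frac1{\rho(x)}\int_0^{\rho(x)}\int_{S^{d-1}}\frac{|L_t(x,\theta)\cap A|}{|L_t(x,\theta)|}\,d\sigma(\theta)\,dt$; - hit-and-run: $H(x,A)=\int_{S^{d-1}}\frac{\int_{L(x,\theta)}\mathbf 1_A(z)\rho(z)\,dz}{\int_{L(x,\theta)}\rho(z)\,dz}\,d\sigma(\theta)$; - simple slice sampler: $S(x,A)=\frac1{\rho(x)}\int_0^{\rho(x)}\frac{\mathrm{vol}_d(A\cap K(t))}{\mathrm{vol}_d(K(t))}\,dt$. Each kernel $P\in\{M,U,H,S\}$ induces a bounded Markov operator on $L_2(\pi)$, also denoted $P$, by $Pf(x)=\int_K f(y)\,P(x,dy)$ for $\pi$-almost every $x$. These operators satisfy, for all $f\in L_2(\pi)$, $$\langle Mf,f\rangle_\pi\ \ge\ \langle Uf,f\rangle_\pi\ \ge\ \langle Hf,f\rangle_\pi\qquad\text{and}\qquad \langle Mf,f\rangle_\pi\ \ge\ \langle Uf,f\rangle_\pi\ \ge\ \langle Sf,f\rangle_\pi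 .$$ -/

import Mathlib

open MeasureTheory Set
open scoped ENNReal

noncomputable section

namespace Samplers

/-- The measure `μ` rescaled to total mass one (meaningful if `0 < μ univ < ∞`). -/
def normalized {α : Type*} [MeasurableSpace α] (μ : Measure α) : Measure α :=
  (μ univ)⁻¹ • μ

variable {d : ℕ}

/-- The target distribution `π(A) = ∫_A ρ dx / ∫_K ρ dx`, `A ⊆ K`, as a measure on `ℝ^d`
concentrated on `K`. -/
def target (K : Set (EuclideanSpace ℝ (Fin d))) (ρ : EuclideanSpace ℝ (Fin d) → ℝ) :
    Measure (EuclideanSpace ℝ (Fin d)) :=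
  normalized ((volume.restrict K).withDensity fun x => ENNReal.ofReal (ρ x))

/-- The uniform distribution on the Euclidean unit sphere. -/
def sphereUniform (d : ℕ) : Measure (Metric.sphere (0 : EuclideanSpace ℝ (Fin d)) 1) :=
  normalized (volume : Measure (EuclideanSpace ℝ (Fin d))).toSphere

/-- One-dimensional Lebesgue measure on the line `{x + s θ | s ∈ ℝ}`; for a unit vector `θ` the
parametrization `s ↦ x + s θ` is an isometry. -/
def lineMeasure (x : EuclideanSpace ℝ (Fin d)) (θ : Metric.sphere (0 : EuclideanSpace ℝ (Fin d)) 1) :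
    Measure (EuclideanSpace ℝ (Fin d)) :=
  Measure.map (fun s : ℝ => x + s • (θ : EuclideanSpace ℝ (Fin d))) volume

/-- The chord in `G` through `x` in direction `θ`. -/
def chord (G : Set (EuclideanSpace ℝ (Fin d))) (x : EuclideanSpace ℝ (Fin d))
    (θ : Metric.sphere (0 : EuclideanSpace ℝ (Fin d)) 1) : Set (EuclideanSpace ℝ (Fin d)) :=
  {z | z ∈ G ∧ ∃ s : ℝ, z = x + s • (θ : EuclideanSpace ℝ (Fin d))}

/-- The level set `K(t) = {x ∈ K | ρ(x) > t}`. -/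
def levelSet (K : Set (EuclideanSpace ℝ (Fin d))) (ρ : EuclideanSpace ℝ (Fin d) → ℝ) (t : ℝ) :
    Set (EuclideanSpace ℝ (Fin d)) :=
  {x | x ∈ K ∧ t < ρ x}

/-- Hit-and-run: sample `θ` uniformly on the sphere, then sample from the distribution
proportional to `ρ` on the chord of `K` through `x` in direction `θ`. -/
def hitAndRun (K : Set (EuclideanSpace ℝ (Fin d))) (ρ : EuclideanSpace ℝ (Fin d) → ℝ)
    (x : EuclideanSpace ℝ (Fin d)) : Measure (EuclideanSpace ℝ (Fin d)) :=
  (sphereUniform d).bind fun θ =>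
    normalized (((lineMeasure x θ).restrict (chord K x θ)).withDensity
      fun z => ENNReal.ofReal (ρ z))

/-- Simple slice sampler: sample `t` uniformly on `(0, ρ(x))`, then sample uniformly on `K(t)`. -/
def simpleSlice (K : Set (EuclideanSpace ℝ (Fin d))) (ρ : EuclideanSpace ℝ (Fin d) → ℝ)
    (x : EuclideanSpace ℝ (Fin d)) : Measure (EuclideanSpace ℝ (Fin d)) :=
  (normalized (volume.restrict (Ioo 0 (ρ x)))).bind fun t =>
    normalized (volume.restrict (levelSet K ρ t))

/-- Hybrid slice sampler based on hit-and-run: sample independently `t` uniformly on `(0, ρ(x))`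
and `θ` uniformly on the sphere, then sample uniformly on the chord of `K(t)` through `x` in
direction `θ`. -/
def hybridSlice (K : Set (EuclideanSpace ℝ (Fin d))) (ρ : EuclideanSpace ℝ (Fin d) → ℝ)
    (x : EuclideanSpace ℝ (Fin d)) : Measure (EuclideanSpace ℝ (Fin d)) :=
  ((normalized (volume.restrict (Ioo 0 (ρ x)))).prod (sphereUniform d)).bind fun p =>
    normalized ((lineMeasure x p.2).restrict (chord (levelSet K ρ p.1) x p.2))

/-- The acceptance probability: `min {1, ρ(y)/ρ(x)}` for `x, y ∈ K`, and `0` otherwise. -/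
def acceptance (K : Set (EuclideanSpace ℝ (Fin d))) (ρ : EuclideanSpace ℝ (Fin d) → ℝ)
    (x y : EuclideanSpace ℝ (Fin d)) : ℝ :=
  (K ×ˢ K).indicator (fun p => min 1 (ρ p.2 / ρ p.1)) (x, y)

/-- The part of the lazy random walk Metropolis transition that comes from accepted proposals:
`A ↦ (1/2) ∫_K 1_A(y) α(x,y) q(y-x) dy`. -/
def metropolisMove (K : Set (EuclideanSpace ℝ (Fin d))) (ρ q : EuclideanSpace ℝ (Fin d) → ℝ)
    (x : EuclideanSpace ℝ (Fin d)) : Measure (EuclideanSpace ℝ (Fin d)) :=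
  (volume.restrict K).withDensity fun y =>
    ENNReal.ofReal (1 / 2 * (acceptance K ρ x y * q (y - x)))

/-- Lazy random walk Metropolis with proposal density `q`: the remaining mass stays at `x`. -/
def metropolis (K : Set (EuclideanSpace ℝ (Fin d))) (ρ q : EuclideanSpace ℝ (Fin d) → ℝ)
    (x : EuclideanSpace ℝ (Fin d)) : Measure (EuclideanSpace ℝ (Fin d)) :=
  metropolisMove K ρ q x + (1 - metropolisMove K ρ q x (K \ {x})) • Measure.dirac x

/-- `q` is a rotationally invariant probability density on `ℝ^d`. -/
structure IsRotInvDensity (q : EuclideanSpace ℝ (Fin d) → ℝ) : Prop where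
  measurable : Measurable q
  nonneg : ∀ z, 0 ≤ q z
  integral_eq_one : ∫ z, q z = 1
  rotInv : ∀ (r : ℝ) (θ₁ θ₂ : Metric.sphere (0 : EuclideanSpace ℝ (Fin d)) 1),
    q (r • (θ₁ : EuclideanSpace ℝ (Fin d))) = q (r • (θ₂ : EuclideanSpace ℝ (Fin d)))

/-- `P` is the Markov operator on `L_2(π)` induced by the transition probabilities `κ(x, dy)`:
these are probability measures for `π`-almost every `x`, and for every square integrable `f`
(any representative) `P f (x) = ∫ f(y) κ(x, dy)` for `π`-almost every `x`, with `f` integrable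
with respect to `κ(x, ·)`. These properties determine `P`. -/
structure IsMarkovOperator {α : Type*} [MeasurableSpace α] (π : Measure α) (κ : α → Measure α)
    (P : Lp ℝ 2 π →L[ℝ] Lp ℝ 2 π) : Prop where
  isProb : ∀ᵐ x ∂π, IsProbabilityMeasure (κ x)
  apply_ae : ∀ (f : α → ℝ) (hf : MemLp f 2 π),
    ∀ᵐ x ∂π, Integrable f (κ x) ∧ P (hf.toLp f) x = ∫ y, f y ∂(κ x)

/-- The covariance ordering `P₁ ≥ P₂`: `⟨P₁ f, f⟩_π ≥ ⟨P₂ f, f⟩_π` for all `f ∈ L_2(π)`. -/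
def CovGE {α : Type*} [MeasurableSpace α] {π : Measure α}
    (P₁ P₂ : Lp ℝ 2 π →L[ℝ] Lp ℝ 2 π) : Prop :=
  ∀ f : Lp ℝ 2 π, inner ℝ (P₁ f) f ≥ inner ℝ (P₂ f) f

end Samplers

end

/-!
Each sampler is a mixture, over an auxiliary height `t`, a direction `θ` or both, of kernels that
preserve the corresponding conditional distribution, and the Dirichlet form of a mixture is the
mixture of the Dirichlet forms; a smaller Dirichlet form means a larger `⟨P f, f⟩`. A kernel that
resamples from a conditional law has as its Dirichlet form twice the mean square distance from `f`
to the functions it leaves constant, so it grows with the amount of information forgotten. Given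
the height and the direction, `U` resamples on a chord, whereas `S` also forgets which line the
point is on and `H` also forgets the height; hence `U ≥ S` and `U ≥ H`. A Metropolis step inside a
level set moves along a line on which the mean of `f` over the chord is constant; comparing both
endpoints of the step with that mean costs a factor which the laziness `1 / 2` absorbs, so `M ≥ U`.
-/

namespace Samplers

open ProbabilityTheory
open scoped NNReal

section Variance

variable {α : Type*} [MeasurableSpace α]

lemma eLpNorm_two_sq {μ : Measure α} {f : α → ℝ} : eLpNorm f 2 μ ^ 2 = ∫⁻ x, ‖f x‖ₑ ^ 2 ∂μ := by
  simpa using eLpNorm_nnreal_pow_eq_lintegral (f := f) (μ := μ) (p := 2) two_ne_zero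

variable {ν : Measure α} [IsProbabilityMeasure ν] {f : α → ℝ}

lemma lintegral_enorm_sub_sq (hf : AEStronglyMeasurable f ν) (c : ℝ) :
    ∫⁻ x, ‖f x - c‖ₑ ^ 2 ∂ν = evariance f ν + ‖ν[f] - c‖ₑ ^ 2 := by
  by_cases hL : MemLp f 2 ν
  · have hLc : MemLp (fun x => f x - c) 2 ν := hL.sub (memLp_const c)
    have hmean : ν[fun x => f x - c] = ν[f] - c := by
      rw [integral_sub (hL.integrable one_le_two) (integrable_const c)]; simp
    have hvar : Var[f; ν] + (ν[f] - c) ^ 2 = ∫ x, (f x - c) ^ 2 ∂ν := by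
      rw [← variance_sub_const hf c, variance_eq_sub hLc, hmean]; simp
    simp_rw [← enorm_pow, Real.enorm_of_nonneg (sq_nonneg _)]
    rw [← ofReal_variance hL, ← ENNReal.ofReal_add (variance_nonneg f ν) (sq_nonneg _), hvar,
      ofReal_integral_eq_lintegral_ofReal hLc.integrable_sq (ae_of_all _ fun x => sq_nonneg _)]
  · rw [evariance_eq_top hf hL, top_add, ← eLpNorm_two_sq, ENNReal.pow_eq_top_iff]
    refine ⟨not_lt_top_iff.1 fun hfin => hL ?_, two_ne_zero⟩
    have hLc : MemLp (fun x => f x - c) 2 ν := ⟨hf.sub aestronglyMeasurable_const, hfin⟩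
    exact (hLc.add (memLp_const c)).ae_eq (.of_forall fun x => sub_add_cancel (f x) c)

lemma lintegral_lintegral_enorm_sub_sq (hf : AEStronglyMeasurable f ν) :
    ∫⁻ x, ∫⁻ y, ‖f x - f y‖ₑ ^ 2 ∂ν ∂ν = 2 * evariance f ν := by
  have hinner (x : α) : ∫⁻ y, ‖f x - f y‖ₑ ^ 2 ∂ν = evariance f ν + ‖f x - ν[f]‖ₑ ^ 2 := by
    simp_rw [enorm_sub_rev (f x)]
    exact lintegral_enorm_sub_sq hf (f x)
  simp_rw [hinner]
  rw [lintegral_add_left measurable_const, lintegral_const, measure_univ, mul_one, two_mul]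
  rfl

end Variance

section SubMarkov

variable {α β : Type*} [MeasurableSpace α] [MeasurableSpace β]

/-- A sub-Markov kernel: all its measures have mass at most one. The kernels built from
`normalized` are of this kind, since rescaling a measure of mass `0` or `∞` gives mass `0`. -/
class IsSubMarkovKernel (κ : Kernel α β) : Prop where
  measure_univ_le_one : ∀ x, κ x univ ≤ 1

instance (κ : Kernel α β) [IsSubMarkovKernel κ] : IsFiniteKernel κ :=
  ⟨1, ENNReal.one_lt_top, IsSubMarkovKernel.measure_univ_le_one⟩

variable {μ : Measure α} {κ : Kernel α α}

lemma lintegral_lintegral_of_invariant (h : κ.Invariant μ) {F : α → ℝ≥0∞} (hF : Measurable F) :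
    ∫⁻ x, ∫⁻ y, F y ∂κ x ∂μ = ∫⁻ x, F x ∂μ := by
  conv_rhs => rw [← h.def, Measure.lintegral_bind κ.aemeasurable hF.aemeasurable]

lemma ae_ae_of_invariant (h : κ.Invariant μ) {p : α → Prop} (hp : ∀ᵐ x ∂μ, p x) :
    ∀ᵐ x ∂μ, ∀ᵐ y ∂κ x, p y :=
  Measure.ae_ae_of_ae_bind κ.aemeasurable (by rwa [h.def])

lemma ae_isProbabilityMeasure_of_invariant [IsFiniteMeasure μ] [IsSubMarkovKernel κ]
    (h : κ.Invariant μ) : ∀ᵐ x ∂μ, IsProbabilityMeasure (κ x) := by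
  have hmass : ∫⁻ _, 1 ∂μ ≤ ∫⁻ x, κ x univ ∂μ := by
    simpa using (lintegral_lintegral_of_invariant h measurable_one).ge
  filter_upwards [ae_eq_of_ae_le_of_lintegral_le
    (ae_of_all _ IsSubMarkovKernel.measure_univ_le_one)
    ((lintegral_mono IsSubMarkovKernel.measure_univ_le_one).trans_lt (by simp)).ne
    aemeasurable_const hmass] with x hx
  exact ⟨hx⟩

end SubMarkov

section MarkovOperator

variable {α : Type*} [MeasurableSpace α] {π : Measure α} {κ κ' : Kernel α α} {f : α → ℝ}

lemma eLpNorm_integral_le [IsFiniteMeasure π] [IsSubMarkovKernel κ] (h : κ.Invariant π)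
    (hf : Measurable f) : eLpNorm (fun x => ∫ y, f y ∂κ x) 2 π ≤ eLpNorm f 2 π := by
  rw [← ENNReal.pow_le_pow_left_iff two_ne_zero, eLpNorm_two_sq, eLpNorm_two_sq,
    ← lintegral_lintegral_of_invariant h (hf.enorm.pow_const 2)]
  refine lintegral_mono_ae ?_
  filter_upwards [ae_isProbabilityMeasure_of_invariant h] with x hx
  simpa using (lintegral_enorm_sub_sq hf.aestronglyMeasurable 0).ge.trans' le_add_self

lemma memLp_integral_of_invariant [IsFiniteMeasure π] [IsSubMarkovKernel κ]
    (h : κ.Invariant π) (hf : Measurable f) (hL : MemLp f 2 π) :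
    MemLp (fun x => ∫ y, f y ∂κ x) 2 π :=
  ⟨hf.stronglyMeasurable.integral_kernel.aestronglyMeasurable,
    (eLpNorm_integral_le h hf).trans_lt hL.2⟩

lemma ae_memLp_of_invariant (h : κ.Invariant π) (hf : Measurable f) (hL : MemLp f 2 π) :
    ∀ᵐ x ∂π, MemLp f 2 (κ x) := by
  have hm : Measurable fun x => ‖f x‖ₑ ^ 2 := hf.enorm.pow_const 2
  have hfin : ∫⁻ x, ∫⁻ y, ‖f y‖ₑ ^ 2 ∂κ x ∂π ≠ ∞ := by
    rw [lintegral_lintegral_of_invariant h hm, ← eLpNorm_two_sq]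
    exact ENNReal.pow_ne_top hL.2.ne
  filter_upwards [ae_lt_top hm.lintegral_kernel hfin] with x hx
  rw [← eLpNorm_two_sq, ENNReal.pow_lt_top_iff, or_iff_left two_ne_zero] at hx
  exact ⟨hf.aestronglyMeasurable, hx⟩

lemma ae_integrable_of_invariant [IsFiniteKernel κ] (h : κ.Invariant π) (f : Lp ℝ 2 π) :
    ∀ᵐ x ∂π, Integrable f (κ x) := by
  filter_upwards [ae_memLp_of_invariant h (Lp.stronglyMeasurable f).measurable (Lp.memLp f)]
    with x hx
  exact hx.integrable one_le_two

/-- The operator `f ↦ (x ↦ ∫ f dκ(x, ·))` on `L²(π)` induced by a kernel `κ` that leaves `π`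
invariant. -/
noncomputable def markovOperator [IsFiniteMeasure π] [IsSubMarkovKernel κ] (h : κ.Invariant π) :
    Lp ℝ 2 π →L[ℝ] Lp ℝ 2 π :=
  have hmem (f : Lp ℝ 2 π) : MemLp (fun x => ∫ y, f y ∂κ x) 2 π :=
    memLp_integral_of_invariant h (Lp.stronglyMeasurable f).measurable (Lp.memLp f)
  LinearMap.mkContinuous
    { toFun f := (hmem f).toLp
      map_add' f g := by
        rw [← MemLp.toLp_add, MemLp.toLp_eq_toLp_iff]
        filter_upwards [ae_integrable_of_invariant h f, ae_integrable_of_invariant h g,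
          ae_ae_of_invariant h (Lp.coeFn_add f g)] with x hf hg hfg
        rw [integral_congr_ae hfg]
        exact integral_add hf hg
      map_smul' c f := by
        rw [RingHom.id_apply, ← MemLp.toLp_const_smul, MemLp.toLp_eq_toLp_iff]
        filter_upwards [ae_ae_of_invariant h (Lp.coeFn_smul c f)] with x hf
        rw [integral_congr_ae hf]
        exact integral_smul c _ }
    1 fun f => by
      rw [one_mul]
      change ‖(hmem f).toLp‖ ≤ ‖f‖
      rw [← enorm_le_iff_norm_le, Lp.enorm_toLp, Lp.enorm_def]
      exact eLpNorm_integral_le h (Lp.stronglyMeasurable f).measurable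

theorem isMarkovOperator_markovOperator [IsFiniteMeasure π] [IsSubMarkovKernel κ]
    (h : κ.Invariant π) : IsMarkovOperator π κ (markovOperator h) where
  isProb := ae_isProbabilityMeasure_of_invariant h
  apply_ae f hf := by
    filter_upwards [ae_integrable_of_invariant h hf.toLp, ae_ae_of_invariant h hf.coeFn_toLp,
      MemLp.coeFn_toLp (memLp_integral_of_invariant h (Lp.stronglyMeasurable hf.toLp).measurable
        (Lp.memLp hf.toLp))] with x hint hae hx
    exact ⟨hint.congr hae, hx.trans (integral_congr_ae hae)⟩

lemma IsMarkovOperator.congr_kernel {κ κ' : α → Measure α} {P : Lp ℝ 2 π →L[ℝ] Lp ℝ 2 π}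
    (hP : IsMarkovOperator π κ P) (h : κ =ᵐ[π] κ') : IsMarkovOperator π κ' P where
  isProb := by filter_upwards [hP.isProb, h] with x hx hκ using hκ ▸ hx
  apply_ae f hf := by filter_upwards [hP.apply_ae f hf, h] with x hx hκ using hκ ▸ hx

/-- The Dirichlet form of `κ` with respect to `μ`, as the mean square increment of `f` in one step
of `κ` started in `μ`. This normalization gives `2 ⟨f - κ f, f⟩` when `κ` leaves `μ` invariant. -/
noncomputable def dirichletForm (μ : Measure α) (κ : Kernel α α) (f : α → ℝ) : ℝ≥0∞ :=
  ∫⁻ x, ∫⁻ y, ‖f x - f y‖ₑ ^ 2 ∂κ x ∂μ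

lemma dirichletForm_add_enorm_sq [IsFiniteMeasure π] [IsSubMarkovKernel κ] (h : κ.Invariant π)
    (f : Lp ℝ 2 π) :
    dirichletForm π κ f + ‖markovOperator h f‖ₑ ^ 2 =
      ‖f‖ₑ ^ 2 + ‖markovOperator h f - f‖ₑ ^ 2 := by
  have hf : Measurable f := (Lp.stronglyMeasurable f).measurable
  have hP : markovOperator h f =ᵐ[π] fun x => ∫ y, f y ∂κ x := by
    have := (isMarkovOperator_markovOperator h).apply_ae f (Lp.memLp f)
    rw [Lp.toLp_coeFn] at this
    exact this.mono fun x hx => hx.2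
  have hκf : Measurable fun x => ∫ y, f y ∂κ x :=
    hf.stronglyMeasurable.integral_kernel.measurable
  have hform : dirichletForm π κ f =
      ∫⁻ x, evariance f (κ x) ∂π + ∫⁻ x, ‖∫ y, f y ∂κ x - f x‖ₑ ^ 2 ∂π := by
    have hdiff : Measurable fun x => ‖∫ y, f y ∂κ x - f x‖ₑ ^ 2 := (hκf.sub hf).enorm.pow_const 2
    rw [dirichletForm, ← lintegral_add_right _ hdiff]
    refine lintegral_congr_ae ?_
    filter_upwards [ae_isProbabilityMeasure_of_invariant h] with x hx
    simp_rw [enorm_sub_rev (f x)]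
    exact lintegral_enorm_sub_sq hf.aestronglyMeasurable (f x)
  have hnorm : ‖f‖ₑ ^ 2 = ∫⁻ x, evariance f (κ x) ∂π + ∫⁻ x, ‖∫ y, f y ∂κ x‖ₑ ^ 2 ∂π := by
    rw [Lp.enorm_def, eLpNorm_two_sq, ← lintegral_add_right _ (hκf.enorm.pow_const 2),
      ← lintegral_lintegral_of_invariant h (by fun_prop)]
    refine lintegral_congr_ae ?_
    filter_upwards [ae_isProbabilityMeasure_of_invariant h] with x hx
    simpa using lintegral_enorm_sub_sq (ν := κ x) hf.aestronglyMeasurable 0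
  have hPf : ‖markovOperator h f‖ₑ ^ 2 = ∫⁻ x, ‖∫ y, f y ∂κ x‖ₑ ^ 2 ∂π := by
    rw [Lp.enorm_def, eLpNorm_two_sq]
    exact lintegral_congr_ae (hP.mono fun x hx => by simp only [hx])
  have hPff : ‖markovOperator h f - f‖ₑ ^ 2 = ∫⁻ x, ‖∫ y, f y ∂κ x - f x‖ₑ ^ 2 ∂π := by
    rw [Lp.enorm_def, eLpNorm_two_sq]
    refine lintegral_congr_ae ?_
    filter_upwards [hP, Lp.coeFn_sub (markovOperator h f) f] with x hx hsub
    rw [hsub, Pi.sub_apply, hx]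
  rw [hform, hnorm, hPf, hPff, add_right_comm]

lemma dirichletForm_ne_top [IsFiniteMeasure π] [IsSubMarkovKernel κ] (h : κ.Invariant π)
    (f : Lp ℝ 2 π) : dirichletForm π κ f ≠ ∞ := by
  have hfin : dirichletForm π κ f + ‖markovOperator h f‖ₑ ^ 2 ≠ ∞ := by
    rw [dirichletForm_add_enorm_sq]
    finiteness
  exact (ENNReal.add_ne_top.1 hfin).1

lemma toReal_dirichletForm [IsFiniteMeasure π] [IsSubMarkovKernel κ] (h : κ.Invariant π)
    (f : Lp ℝ 2 π) :
    (dirichletForm π κ f).toReal = 2 * (‖f‖ ^ 2 - inner ℝ (markovOperator h f) f) := by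
  have hadd := congrArg ENNReal.toReal (dirichletForm_add_enorm_sq h f)
  rw [ENNReal.toReal_add (dirichletForm_ne_top h f) (by finiteness),
    ENNReal.toReal_add (by finiteness) (by finiteness)] at hadd
  simp only [ENNReal.toReal_pow, toReal_enorm] at hadd
  linarith [norm_sub_sq_real (markovOperator h f) f]

theorem covGE_of_dirichletForm_le [IsFiniteMeasure π] [IsSubMarkovKernel κ] [IsSubMarkovKernel κ']
    (h : κ.Invariant π) (h' : κ'.Invariant π)
    (hle : ∀ f, Measurable f → dirichletForm π κ f ≤ dirichletForm π κ' f) :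
    CovGE (markovOperator h) (markovOperator h') := fun f => by
  have := ENNReal.toReal_mono (dirichletForm_ne_top h' f)
    (hle f (Lp.stronglyMeasurable f).measurable)
  rw [toReal_dirichletForm h, toReal_dirichletForm h'] at this
  linarith

end MarkovOperator

section Averaging

variable {α : Type*} [MeasurableSpace α] {μ : Measure α} {κ : Kernel α α} {f g : α → ℝ}

lemma measurable_lintegral_enorm_sub_sq (κ : Kernel α α) [IsSFiniteKernel κ] (hf : Measurable f) :
    Measurable fun x => ∫⁻ y, ‖f x - f y‖ₑ ^ 2 ∂κ x :=
  Measurable.lintegral_kernel_prod_right' (f := fun p : α × α => ‖f p.1 - f p.2‖ₑ ^ 2)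
    (by fun_prop)

/-- The kernel `κ` resamples from `μ` conditionally on a sub-`σ`-algebra: it leaves `μ` invariant
and is constant on the set reached from any given point. The operator induced by such a kernel is
an orthogonal projection, onto the functions that are invariant under `κ`. -/
structure IsAveraging (μ : Measure α) (κ : Kernel α α) : Prop where
  invariant : κ.Invariant μ
  ae_eq (x : α) : ∀ᵐ z ∂κ x, κ z = κ x

namespace IsAveraging

variable [IsFiniteMeasure μ] [IsSubMarkovKernel κ]

lemma dirichletForm_eq_lintegral_evariance (h : IsAveraging μ κ) (hf : Measurable f) :
    dirichletForm μ κ f = 2 * ∫⁻ x, evariance f (κ x) ∂μ := by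
  rw [dirichletForm, ← lintegral_const_mul' _ _ ENNReal.ofNat_ne_top,
    ← lintegral_lintegral_of_invariant h.invariant (measurable_lintegral_enorm_sub_sq κ hf)]
  refine lintegral_congr_ae ?_
  filter_upwards [ae_isProbabilityMeasure_of_invariant h.invariant] with x hx
  rw [← lintegral_lintegral_enorm_sub_sq hf.aestronglyMeasurable]
  refine lintegral_congr_ae ?_
  filter_upwards [h.ae_eq x] with z hz
  rw [hz]

lemma dirichletForm_add (h : IsAveraging μ κ) (hf : Measurable f) (hg : Measurable g)
    (hgκ : ∀ x, ∀ᵐ z ∂κ x, g z = g x) :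
    dirichletForm μ κ f + 2 * ∫⁻ x, ‖∫ y, f y ∂κ x - g x‖ₑ ^ 2 ∂μ =
      2 * ∫⁻ x, ‖f x - g x‖ₑ ^ 2 ∂μ := by
  have hκf : Measurable fun x => ∫ y, f y ∂κ x :=
    hf.stronglyMeasurable.integral_kernel.measurable
  have hdiff : Measurable fun x => ‖∫ y, f y ∂κ x - g x‖ₑ ^ 2 := (hκf.sub hg).enorm.pow_const 2
  rw [h.dirichletForm_eq_lintegral_evariance hf, ← mul_add, ← lintegral_add_right _ hdiff,
    ← lintegral_lintegral_of_invariant h.invariant (F := fun x => ‖f x - g x‖ₑ ^ 2) (by fun_prop)]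
  congr 1
  refine lintegral_congr_ae ?_
  filter_upwards [ae_isProbabilityMeasure_of_invariant h.invariant] with x hx
  rw [← lintegral_enorm_sub_sq hf.aestronglyMeasurable]
  refine lintegral_congr_ae ?_
  filter_upwards [hgκ x] with z hz
  rw [hz]

lemma dirichletForm_le (h : IsAveraging μ κ) (hf : Measurable f) (hg : Measurable g)
    (hgκ : ∀ x, ∀ᵐ z ∂κ x, g z = g x) :
    dirichletForm μ κ f ≤ 2 * ∫⁻ x, ‖f x - g x‖ₑ ^ 2 ∂μ :=
  le_self_add.trans_eq (h.dirichletForm_add hf hg hgκ)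

lemma dirichletForm_eq (h : IsAveraging μ κ) (hf : Measurable f) :
    dirichletForm μ κ f = 2 * ∫⁻ x, ‖f x - ∫ y, f y ∂κ x‖ₑ ^ 2 ∂μ := by
  have hconst (x : α) : ∀ᵐ z ∂κ x, ∫ y, f y ∂κ z = ∫ y, f y ∂κ x := by
    filter_upwards [h.ae_eq x] with z hz
    rw [hz]
  simpa using h.dirichletForm_add hf hf.stronglyMeasurable.integral_kernel.measurable hconst

end IsAveraging

lemma IsAveraging.dirichletForm_mono {κ' : Kernel α α} [IsFiniteMeasure μ] [IsSubMarkovKernel κ]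
    [IsSubMarkovKernel κ'] (h : IsAveraging μ κ) (h' : IsAveraging μ κ') (hf : Measurable f)
    (hκκ' : ∀ x, ∀ᵐ z ∂κ x, κ' z = κ' x) :
    dirichletForm μ κ f ≤ dirichletForm μ κ' f := by
  -- The mean of `f` under `κ'` is invariant under `κ`, hence a competitor for the mean under `κ`.
  rw [h'.dirichletForm_eq hf]
  refine h.dirichletForm_le hf hf.stronglyMeasurable.integral_kernel.measurable fun x => ?_
  filter_upwards [hκκ' x] with z hz
  rw [hz]

end Averaging

section Normalized

variable {α β : Type*} [MeasurableSpace α] [MeasurableSpace β]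

lemma normalized_apply (μ : Measure α) (s : Set α) : normalized μ s = (μ univ)⁻¹ * μ s :=
  rfl

lemma lintegral_normalized (μ : Measure α) (F : α → ℝ≥0∞) :
    ∫⁻ x, F x ∂normalized μ = (μ univ)⁻¹ * ∫⁻ x, F x ∂μ :=
  lintegral_smul_measure ..

lemma normalized_univ_le_one (μ : Measure α) : normalized μ univ ≤ 1 :=
  ENNReal.inv_mul_le_one _

instance (μ : Measure α) : IsFiniteMeasure (normalized μ) :=
  ⟨(normalized_univ_le_one μ).trans_lt ENNReal.one_lt_top⟩

lemma isProbabilityMeasure_normalized {μ : Measure α} (h0 : μ univ ≠ 0) (htop : μ univ ≠ ∞) :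
    IsProbabilityMeasure (normalized μ) :=
  ⟨ENNReal.inv_mul_cancel h0 htop⟩

lemma invariant_normalized {μ : Measure α} {κ : Kernel α α} (h : κ.Invariant μ) :
    κ.Invariant (normalized μ) := by
  rw [Kernel.Invariant, normalized, Measure.comp_smul, h.def]

lemma dirichletForm_normalized (μ : Measure α) (κ : Kernel α α) (f : α → ℝ) :
    dirichletForm (normalized μ) κ f = (μ univ)⁻¹ * dirichletForm μ κ f :=
  lintegral_normalized ..

/-- The kernel `κ` with each of its measures rescaled to total mass one. -/
noncomputable def normalizedKernel (κ : Kernel α β) : Kernel α β where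
  toFun x := normalized (κ x)
  measurable' := Measure.measurable_of_measurable_coe _ fun _ hs =>
    (κ.measurable_coe MeasurableSet.univ).inv.mul (κ.measurable_coe hs)

lemma normalizedKernel_apply (κ : Kernel α β) (x : α) :
    normalizedKernel κ x = normalized (κ x) := rfl

instance (κ : Kernel α β) : IsSubMarkovKernel (normalizedKernel κ) :=
  ⟨fun _ => normalized_univ_le_one _⟩

end Normalized

section Reversible

variable {α : Type*} [MeasurableSpace α] {μ : Measure α} {κ : Kernel α α}

lemma bind_eq_withDensity_of_isReversible (h : κ.IsReversible μ) :
    μ.bind κ = μ.withDensity fun x => κ x univ := by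
  ext s hs
  rw [Measure.bind_apply hs κ.aemeasurable, withDensity_apply _ hs,
    h hs MeasurableSet.univ, Measure.restrict_univ]

lemma isAveraging_normalizedKernel (h : κ.IsReversible μ) (hκ : ∀ x, ∀ᵐ z ∂κ x, κ z = κ x)
    (h0 : ∀ᵐ x ∂μ, κ x univ ≠ 0) (htop : ∀ᵐ x ∂μ, κ x univ ≠ ∞) :
    IsAveraging μ (normalizedKernel κ) where
  invariant := by
    refine Measure.ext_of_lintegral _ fun F hF => ?_
    have hmass : Measurable fun x => κ x univ := κ.measurable_coe MeasurableSet.univ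
    have hweight : Measurable fun x => (κ x univ)⁻¹ * F x := hmass.inv.mul hF
    calc ∫⁻ x, F x ∂μ.bind (normalizedKernel κ)
        = ∫⁻ x, ∫⁻ z, (κ x univ)⁻¹ * F z ∂κ x ∂μ := by
          rw [Measure.lintegral_bind (normalizedKernel κ).aemeasurable hF.aemeasurable]
          refine lintegral_congr fun x => ?_
          rw [normalizedKernel_apply, lintegral_normalized, lintegral_const_mul _ hF]
      _ = ∫⁻ x, ∫⁻ z, (κ z univ)⁻¹ * F z ∂κ x ∂μ := by
          refine lintegral_congr fun x => lintegral_congr_ae ?_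
          filter_upwards [hκ x] with z hz
          rw [hz]
      _ = ∫⁻ x, κ x univ * ((κ x univ)⁻¹ * F x) ∂μ := by
          rw [← Measure.lintegral_bind κ.aemeasurable hweight.aemeasurable,
            bind_eq_withDensity_of_isReversible h,
            lintegral_withDensity_eq_lintegral_mul _ hmass hweight]
          rfl
      _ = ∫⁻ x, F x ∂μ := by
          refine lintegral_congr_ae ?_
          filter_upwards [h0, htop] with x hx0 hxtop
          rw [← mul_assoc, ENNReal.mul_inv_cancel hx0 hxtop, one_mul]
  ae_eq x := by
    refine Measure.ae_smul_measure ?_ _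
    filter_upwards [hκ x] with z hz
    rw [normalizedKernel_apply, hz, normalizedKernel_apply]

lemma isAveraging_const_normalized (μ : Measure α) [IsFiniteMeasure μ] :
    IsAveraging μ (normalizedKernel (Kernel.const α μ)) := by
  refine isAveraging_normalizedKernel (fun A B _ _ => ?_) (fun x => ae_of_all _ fun z => rfl) ?_
    (ae_of_all _ fun x => measure_ne_top _ _)
  · simp [mul_comm]
  · rcases eq_or_ne μ 0 with rfl | hμ
    · simp
    · exact ae_of_all _ fun x => by simpa using hμ

/-- The kernel `κ` completed to total mass one by staying at the current point. -/
noncomputable def fillKernel (κ : Kernel α α) : Kernel α α where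
  toFun x := κ x + (1 - κ x univ) • Measure.dirac x
  measurable' := Measure.measurable_of_measurable_coe _ fun s hs => by
    have hmass : Measurable fun x => κ x univ := κ.measurable_coe MeasurableSet.univ
    simp only [Measure.add_apply, Measure.smul_apply, Measure.dirac_apply' _ hs, smul_eq_mul]
    exact (κ.measurable_coe hs).add
      ((measurable_const.sub hmass).mul (measurable_one.indicator hs))

lemma fillKernel_apply (κ : Kernel α α) (x : α) :
    fillKernel κ x = κ x + (1 - κ x univ) • Measure.dirac x := rfl

instance [IsSubMarkovKernel κ] : IsSubMarkovKernel (fillKernel κ) :=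
  ⟨fun x => by simp [fillKernel_apply, IsSubMarkovKernel.measure_univ_le_one]⟩

lemma invariant_fillKernel [IsSubMarkovKernel κ] (h : κ.IsReversible μ) :
    (fillKernel κ).Invariant μ := by
  ext s hs
  have hmass : Measurable fun x => κ x univ := κ.measurable_coe MeasurableSet.univ
  calc μ.bind (fillKernel κ) s
      = ∫⁻ x, κ x s + s.indicator (fun x => 1 - κ x univ) x ∂μ := by
        rw [Measure.bind_apply hs (fillKernel κ).aemeasurable]
        refine lintegral_congr fun x => ?_
        by_cases hx : x ∈ s <;> simp [fillKernel_apply, Measure.dirac_apply' _ hs, hx]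
    _ = ∫⁻ x in s, κ x univ ∂μ + ∫⁻ x in s, 1 - κ x univ ∂μ := by
        rw [lintegral_add_left (κ.measurable_coe hs), lintegral_indicator hs,
          h hs MeasurableSet.univ, Measure.restrict_univ]
    _ = μ s := by
        rw [← lintegral_add_left hmass]
        simp [add_tsub_cancel_of_le (IsSubMarkovKernel.measure_univ_le_one _)]

lemma dirichletForm_fillKernel {f : α → ℝ} (hf : Measurable f) :
    dirichletForm μ (fillKernel κ) f = dirichletForm μ κ f := by
  refine lintegral_congr fun x => ?_
  rw [fillKernel_apply, lintegral_add_measure, lintegral_smul_measure,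
    lintegral_dirac' x (by fun_prop)]
  simp

end Reversible

section Mixture

variable {α β γ : Type*} [MeasurableSpace α] [MeasurableSpace β] [MeasurableSpace γ]

/-- The kernel which from `x` first draws an auxiliary variable `b` from `ν x` and then moves
according to `κ (x, b)`. -/
noncomputable def mixture (ν : Kernel α β) (κ : Kernel (α × β) γ) : Kernel α γ :=
  (ν ⊗ₖ κ).snd

variable {ν : Kernel α β} [IsSFiniteKernel ν]

section

variable {κ : Kernel (α × β) γ} [IsSFiniteKernel κ]

lemma lintegral_mixture (x : α) {F : γ → ℝ≥0∞} (hF : Measurable F) :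
    ∫⁻ y, F y ∂mixture ν κ x = ∫⁻ b, ∫⁻ y, F y ∂κ (x, b) ∂ν x := by
  rw [mixture, Kernel.lintegral_snd _ _ hF, Kernel.lintegral_compProd _ _ _ (by fun_prop)]

lemma mixture_apply (x : α) : mixture ν κ x = (ν x).bind (κ.sectR x) := by
  refine Measure.ext_of_lintegral _ fun F hF => ?_
  rw [lintegral_mixture x hF, Measure.lintegral_bind (κ.sectR x).aemeasurable hF.aemeasurable]
  rfl

end

instance {κ : Kernel (α × β) γ} [IsSubMarkovKernel ν] [IsSubMarkovKernel κ] :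
    IsSubMarkovKernel (mixture ν κ) := by
  refine ⟨fun x => ?_⟩
  calc mixture ν κ x univ = ∫⁻ b, ∫⁻ _, 1 ∂κ (x, b) ∂ν x := by
        rw [← lintegral_mixture x measurable_const, lintegral_const, one_mul]
    _ ≤ ∫⁻ _, 1 ∂ν x := by
        refine lintegral_mono fun b => ?_
        simpa using IsSubMarkovKernel.measure_univ_le_one (κ := κ) (x, b)
    _ ≤ 1 := by simpa using IsSubMarkovKernel.measure_univ_le_one (κ := ν) x

instance {ν : Kernel α β} {ν' : Kernel α γ} [IsSubMarkovKernel ν] [IsSubMarkovKernel ν'] :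
    IsSubMarkovKernel (ν ×ₖ ν') := by
  refine ⟨fun x => ?_⟩
  rw [Kernel.prod_apply, Measure.prod_apply MeasurableSet.univ]
  simpa using mul_le_one' (IsSubMarkovKernel.measure_univ_le_one (κ := ν') x)
    (IsSubMarkovKernel.measure_univ_le_one (κ := ν) x)

instance {κ : Kernel (α × β) γ} [IsSubMarkovKernel κ] (b : β) : IsSubMarkovKernel (κ.sectL b) :=
  ⟨fun x => IsSubMarkovKernel.measure_univ_le_one (κ := κ) (x, b)⟩

variable {κ : Kernel (α × β) α} [IsSFiniteKernel κ] {μ : Measure α} {τ : Measure β}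
  {η : Kernel β α} [SFinite μ] [SFinite τ] [IsSFiniteKernel η]

lemma lintegral_lintegral_of_compProd_eq (h : τ ⊗ₘ η = (μ ⊗ₘ ν).map Prod.swap)
    {G : α → β → ℝ≥0∞} (hG : Measurable (Function.uncurry G)) :
    ∫⁻ x, ∫⁻ b, G x b ∂ν x ∂μ = ∫⁻ b, ∫⁻ x, G x b ∂η b ∂τ := by
  have hswap : Measurable fun p : β × α => G p.2 p.1 := hG.comp measurable_swap
  calc ∫⁻ x, ∫⁻ b, G x b ∂ν x ∂μ = ∫⁻ p, Function.uncurry G p ∂(μ ⊗ₘ ν) :=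
        (Measure.lintegral_compProd hG).symm
    _ = ∫⁻ p, G p.2 p.1 ∂(τ ⊗ₘ η) := by
        rw [h, lintegral_map hswap measurable_swap]
        rfl
    _ = ∫⁻ b, ∫⁻ x, G x b ∂η b ∂τ := Measure.lintegral_compProd hswap

lemma invariant_mixture (h : τ ⊗ₘ η = (μ ⊗ₘ ν).map Prod.swap)
    (hν : ∀ᵐ x ∂μ, IsProbabilityMeasure (ν x)) (hκ : ∀ᵐ b ∂τ, (κ.sectL b).Invariant (η b)) :
    (mixture ν κ).Invariant μ := by
  refine Measure.ext_of_lintegral _ fun F hF => ?_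
  calc ∫⁻ y, F y ∂μ.bind (mixture ν κ)
      = ∫⁻ x, ∫⁻ b, ∫⁻ y, F y ∂κ (x, b) ∂ν x ∂μ := by
        rw [Measure.lintegral_bind (mixture ν κ).aemeasurable hF.aemeasurable]
        exact lintegral_congr fun x => lintegral_mixture x hF
    _ = ∫⁻ b, ∫⁻ x, ∫⁻ y, F y ∂κ.sectL b x ∂η b ∂τ :=
        lintegral_lintegral_of_compProd_eq h hF.lintegral_kernel
    _ = ∫⁻ b, ∫⁻ x, F x ∂η b ∂τ :=
        lintegral_congr_ae (hκ.mono fun b hb => lintegral_lintegral_of_invariant hb hF)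
    _ = ∫⁻ x, ∫⁻ _, F x ∂ν x ∂μ :=
        (lintegral_lintegral_of_compProd_eq h (G := fun x _ => F x) (hF.comp measurable_fst)).symm
    _ = ∫⁻ x, F x ∂μ := by
        refine lintegral_congr_ae ?_
        filter_upwards [hν] with x hx
        simp

lemma isReversible_mixture (h : τ ⊗ₘ η = (μ ⊗ₘ ν).map Prod.swap)
    (hκ : ∀ᵐ b ∂τ, (κ.sectL b).IsReversible (η b)) : (mixture ν κ).IsReversible μ := by
  have hflow {A B : Set α} (hA : MeasurableSet A) (hB : MeasurableSet B) :
      ∫⁻ x in A, mixture ν κ x B ∂μ = ∫⁻ b, ∫⁻ x in A, κ.sectL b x B ∂η b ∂τ := by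
    have hmeas : Measurable (Function.uncurry fun x b => A.indicator (fun x => κ (x, b) B) x) := by
      have := (κ.measurable_coe hB).indicator (measurable_fst hA)
      exact this
    simp_rw [← lintegral_indicator hA, Kernel.sectL_apply]
    rw [← lintegral_lintegral_of_compProd_eq h hmeas]
    refine lintegral_congr fun x => ?_
    by_cases hx : x ∈ A
    · simp only [indicator_of_mem hx]
      rw [mixture_apply, Measure.bind_apply hB (κ.sectR x).aemeasurable]
      rfl
    · simp [indicator_of_notMem hx]
  intro A B hA hB
  rw [hflow hA hB, hflow hB hA]
  exact lintegral_congr_ae (hκ.mono fun b hb => hb hA hB)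

lemma dirichletForm_mixture (h : τ ⊗ₘ η = (μ ⊗ₘ ν).map Prod.swap) {f : α → ℝ}
    (hf : Measurable f) :
    dirichletForm μ (mixture ν κ) f = ∫⁻ b, dirichletForm (η b) (κ.sectL b) f ∂τ := by
  have hmeas : Measurable (Function.uncurry fun x b => ∫⁻ y, ‖f x - f y‖ₑ ^ 2 ∂κ (x, b)) :=
    Measurable.lintegral_kernel_prod_right'
      (f := fun p : (α × β) × α => ‖f p.1.1 - f p.2‖ₑ ^ 2) (by fun_prop)
  calc dirichletForm μ (mixture ν κ) f
      = ∫⁻ x, ∫⁻ b, ∫⁻ y, ‖f x - f y‖ₑ ^ 2 ∂κ (x, b) ∂ν x ∂μ :=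
        lintegral_congr fun x => lintegral_mixture x (by fun_prop)
    _ = ∫⁻ b, dirichletForm (η b) (κ.sectL b) f ∂τ := lintegral_lintegral_of_compProd_eq h hmeas

omit [SFinite μ] in
lemma lintegral_dirichletForm_le (h : τ ⊗ₘ η = (μ ⊗ₘ ν).map Prod.swap) [IsFiniteMeasure μ]
    [∀ b, IsFiniteMeasure (η b)] (hν : ∀ᵐ x ∂μ, IsProbabilityMeasure (ν x)) {κ : β → Kernel α α}
    [∀ b, IsSubMarkovKernel (κ b)] {κ' : Kernel α α} [IsSubMarkovKernel κ']
    (hκ : ∀ b, IsAveraging (η b) (κ b)) (hκ' : IsAveraging μ κ')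
    (hκκ' : ∀ b x, ∀ᵐ z ∂κ b x, κ' z = κ' x) {f : α → ℝ} (hf : Measurable f) :
    ∫⁻ b, dirichletForm (η b) (κ b) f ∂τ ≤ dirichletForm μ κ' f := by
  -- The mean of `f` under `κ'` competes with the means of `f` under all the `κ b` at once.
  set g : α → ℝ := fun x => ∫ y, f y ∂κ' x with hg_def
  have hg : Measurable g := hf.stronglyMeasurable.integral_kernel.measurable
  have hgκ (b : β) (x : α) : ∀ᵐ z ∂κ b x, g z = g x := by
    filter_upwards [hκκ' b x] with z hz
    simp only [hg_def, hz]
  calc ∫⁻ b, dirichletForm (η b) (κ b) f ∂τ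
      ≤ ∫⁻ b, 2 * ∫⁻ x, ‖f x - g x‖ₑ ^ 2 ∂η b ∂τ :=
        lintegral_mono fun b => (hκ b).dirichletForm_le hf hg (hgκ b)
    _ = 2 * ∫⁻ x, ∫⁻ _, ‖f x - g x‖ₑ ^ 2 ∂ν x ∂μ := by
        rw [lintegral_const_mul' _ _ ENNReal.ofNat_ne_top,
          lintegral_lintegral_of_compProd_eq h (G := fun x _ => ‖f x - g x‖ₑ ^ 2) (by fun_prop)]
    _ = 2 * ∫⁻ x, ‖f x - g x‖ₑ ^ 2 ∂μ := by
        congr 1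
        refine lintegral_congr_ae ?_
        filter_upwards [hν] with x hx
        simp
    _ = dirichletForm μ κ' f := (hκ'.dirichletForm_eq hf).symm

lemma measurable_dirichletForm_sectL (η : Kernel β α) [IsSFiniteKernel η]
    (κ : Kernel (α × β) α) [IsSFiniteKernel κ] {f : α → ℝ} (hf : Measurable f) :
    Measurable fun b => dirichletForm (η b) (κ.sectL b) f := by
  have hinner : Measurable fun p : α × β => ∫⁻ y, ‖f p.1 - f y‖ₑ ^ 2 ∂κ p :=
    Measurable.lintegral_kernel_prod_right'
      (f := fun p : (α × β) × α => ‖f p.1.1 - f p.2‖ₑ ^ 2) (by fun_prop)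
  exact Measurable.lintegral_kernel_prod_right' (f := fun p : β × α =>
    ∫⁻ y, ‖f p.2 - f y‖ₑ ^ 2 ∂κ p.swap) (hinner.comp measurable_swap)

lemma compProd_const_eq_map_swap (μ : Measure α) [SFinite μ] (τ : Measure β) [SFinite τ] :
    τ ⊗ₘ Kernel.const β μ = (μ ⊗ₘ Kernel.const α τ).map Prod.swap := by
  rw [Measure.compProd_const, Measure.compProd_const, Measure.prod_swap]

lemma compProd_prod_const_eq_map_swap (h : τ ⊗ₘ η = (μ ⊗ₘ ν).map Prod.swap) (σ : Measure γ)
    [SFinite σ] :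
    τ.prod σ ⊗ₘ η.prodMkRight γ = (μ ⊗ₘ (ν ×ₖ Kernel.const α σ)).map Prod.swap := by
  refine Measure.ext_of_lintegral _ fun F hF => ?_
  have hG : Measurable (Function.uncurry fun x b => ∫⁻ c, F ((b, c), x) ∂σ) :=
    Measurable.lintegral_prod_right' (f := fun p : (α × β) × γ => F ((p.1.2, p.2), p.1.1))
      (by fun_prop)
  have hHt (b : β) : Measurable (Function.uncurry fun c x => F ((b, c), x)) := by fun_prop
  rw [lintegral_map hF measurable_swap, Measure.lintegral_compProd hF,
    Measure.lintegral_compProd (f := fun p => F p.swap) (hF.comp measurable_swap),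
    lintegral_prod _ (Measurable.lintegral_kernel_prod_right' hF).aemeasurable]
  simp only [Kernel.prodMkRight_apply, Kernel.prod_apply, Kernel.const_apply, Prod.swap_prod_mk]
  calc ∫⁻ b, ∫⁻ c, ∫⁻ x, F ((b, c), x) ∂η b ∂σ ∂τ
      = ∫⁻ b, ∫⁻ x, ∫⁻ c, F ((b, c), x) ∂σ ∂η b ∂τ :=
        lintegral_congr fun b => lintegral_lintegral_swap (hHt b).aemeasurable
    _ = ∫⁻ x, ∫⁻ b, ∫⁻ c, F ((b, c), x) ∂σ ∂ν x ∂μ :=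
        (lintegral_lintegral_of_compProd_eq h hG).symm
    _ = ∫⁻ x, ∫⁻ p, F (p, x) ∂(ν x).prod σ ∂μ := by
        refine lintegral_congr fun x => ?_
        rw [lintegral_prod _ (by fun_prop)]

end Mixture

section WithDensity

variable {α β : Type*} [MeasurableSpace α] [MeasurableSpace β]

lemma withDensity_compProd_normalizedKernel (μ : Measure α) [SFinite μ] (κ : Kernel α β)
    [IsSFiniteKernel κ] (hκ : ∀ x, κ x univ ≠ ∞) :
    (μ.withDensity fun x => κ x univ) ⊗ₘ normalizedKernel κ = μ ⊗ₘ κ := by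
  refine Measure.ext_of_lintegral _ fun F hF => ?_
  rw [Measure.lintegral_compProd hF, Measure.lintegral_compProd hF,
    lintegral_withDensity_eq_lintegral_mul _ (κ.measurable_coe MeasurableSet.univ)
      (Measurable.lintegral_kernel_prod_right' hF)]
  refine lintegral_congr fun x => ?_
  rw [Pi.mul_apply, normalizedKernel_apply, lintegral_normalized, ← mul_assoc]
  by_cases hx : κ x univ = 0
  · simp [Measure.measure_univ_eq_zero.1 hx]
  · rw [ENNReal.mul_inv_cancel hx (hκ x), one_mul]

lemma compProd_const_withDensity_eq_map_swap (μ : Measure α) [SFinite μ] (τ : Measure β)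
    [SFinite τ] {k : α → β → ℝ≥0∞} (hk : Measurable (Function.uncurry k))
    (hk_top : ∀ x b, k x b ≠ ∞) :
    τ ⊗ₘ (Kernel.const β μ).withDensity (fun b x => k x b) =
      (μ ⊗ₘ (Kernel.const α τ).withDensity k).map Prod.swap := by
  have hk' : Measurable (Function.uncurry fun b x => k x b) := hk.comp measurable_swap
  have := Kernel.IsSFiniteKernel.withDensity (Kernel.const β μ) fun b x => hk_top x b
  have := Kernel.IsSFiniteKernel.withDensity (Kernel.const α τ) hk_top
  refine Measure.ext_of_lintegral _ fun F hF => ?_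
  rw [lintegral_map hF measurable_swap, Measure.lintegral_compProd hF,
    Measure.lintegral_compProd (f := fun p => F p.swap) (hF.comp measurable_swap)]
  have hinner (b : β) : ∫⁻ x, F (b, x) ∂(Kernel.const β μ).withDensity (fun b x => k x b) b =
      ∫⁻ x, k x b * F (b, x) ∂μ := Kernel.lintegral_withDensity _ hk' b (by fun_prop)
  have hinner' (x : α) : ∫⁻ b, F (b, x) ∂(Kernel.const α τ).withDensity k x =
      ∫⁻ b, k x b * F (b, x) ∂τ := Kernel.lintegral_withDensity _ hk x (by fun_prop)
  simp only [Prod.swap_prod_mk, hinner, hinner']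
  exact lintegral_lintegral_swap (by fun_prop)

end WithDensity

section Slice

variable {α : Type*}

/-- The indicator function of the level set `{x | t < w x}`, as a function of the height `t`, which
is restricted to positive values, and of `x`. -/
noncomputable def levelDensity (w : α → ℝ) (t : ℝ) (x : α) : ℝ≥0∞ :=
  (Ioo 0 (w x)).indicator 1 t

lemma levelDensity_le_one (w : α → ℝ) (t : ℝ) (x : α) : levelDensity w t x ≤ 1 :=
  indicator_le_self _ _ _

lemma levelDensity_ne_top (w : α → ℝ) (t : ℝ) (x : α) : levelDensity w t x ≠ ∞ :=
  ((levelDensity_le_one w t x).trans_lt ENNReal.one_lt_top).ne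

lemma withDensity_levelDensity (w : α → ℝ) (x : α) :
    (volume.withDensity fun t => levelDensity w t x) = volume.restrict (Ioo 0 (w x)) :=
  withDensity_indicator_one measurableSet_Ioo

variable [MeasurableSpace α] {w : α → ℝ} {ν : Measure α}

lemma measurable_levelDensity (hw : Measurable w) :
    Measurable (Function.uncurry (levelDensity w)) :=
  (measurable_one (α := ℝ≥0∞)).indicator ((measurableSet_lt measurable_const measurable_fst).inter
    (measurableSet_lt measurable_fst (hw.comp measurable_snd)))

lemma lintegral_levelDensity_ne_top (hint : ∫⁻ x, ENNReal.ofReal (w x) ∂ν ≠ ∞) (t : ℝ) :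
    ∫⁻ x, levelDensity w t x ∂ν ≠ ∞ := by
  by_cases ht : 0 < t
  · have hle (x : α) : ENNReal.ofReal t * levelDensity w t x ≤ ENNReal.ofReal (w x) := by
      by_cases hx : t ∈ Ioo 0 (w x)
      · simpa [levelDensity, hx] using ENNReal.ofReal_le_ofReal hx.2.le
      · simp [levelDensity, hx]
    have h := lintegral_mono (μ := ν) hle
    rw [lintegral_const_mul' _ _ ENNReal.ofReal_ne_top] at h
    exact fun htop => (h.trans_lt hint.lt_top).ne
      (by rw [htop, ENNReal.mul_top (ENNReal.ofReal_pos.2 ht).ne'])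
  · simp [levelDensity, ht]

/-- The kernel which draws a height uniformly from `(0, w x)`. -/
noncomputable def heightKernel (w : α → ℝ) : Kernel α ℝ :=
  normalizedKernel ((Kernel.const α volume).withDensity fun x t => levelDensity w t x)

/-- The restriction of `ν` to the level set of `w` at height `t`, as a kernel in `t`. -/
noncomputable def levelKernel (ν : Measure α) [SFinite ν] (w : α → ℝ) : Kernel ℝ α :=
  (Kernel.const ℝ ν).withDensity (levelDensity w)

instance [SFinite ν] : IsSFiniteKernel (levelKernel ν w) :=
  Kernel.IsSFiniteKernel.withDensity _ (levelDensity_ne_top w)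

instance : IsSubMarkovKernel (heightKernel w) :=
  inferInstanceAs (IsSubMarkovKernel (normalizedKernel _))

lemma levelKernel_apply [SFinite ν] (hw : Measurable w) (t : ℝ) :
    levelKernel ν w t = ν.withDensity (levelDensity w t) :=
  Kernel.withDensity_apply _ (measurable_levelDensity hw) t

lemma heightKernel_apply (hw : Measurable w) (x : α) :
    heightKernel w x = normalized (volume.restrict (Ioo 0 (w x))) := by
  have hk : Measurable (Function.uncurry fun x t => levelDensity w t x) :=
    (measurable_levelDensity hw).comp measurable_swap
  rw [heightKernel, normalizedKernel_apply, Kernel.withDensity_apply _ hk, Kernel.const_apply,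
    withDensity_levelDensity]

lemma compProd_levelKernel [SFinite ν] (hw : Measurable w) :
    volume ⊗ₘ levelKernel ν w =
      ((ν.withDensity fun x => ENNReal.ofReal (w x)) ⊗ₘ heightKernel w).map Prod.swap := by
  have hk : Measurable (Function.uncurry fun x t => levelDensity w t x) :=
    (measurable_levelDensity hw).comp measurable_swap
  set κ : Kernel α ℝ := (Kernel.const α volume).withDensity fun x t => levelDensity w t x
  have : IsSFiniteKernel κ :=
    Kernel.IsSFiniteKernel.withDensity _ fun x t => levelDensity_ne_top w t x
  have hmass (x : α) : κ x univ = ENNReal.ofReal (w x) := by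
    rw [Kernel.withDensity_apply _ hk, Kernel.const_apply, withDensity_levelDensity]
    simp
  have h := withDensity_compProd_normalizedKernel ν κ fun x => by
    rw [hmass]
    exact ENNReal.ofReal_ne_top
  simp only [hmass] at h
  rw [heightKernel, h]
  exact compProd_const_withDensity_eq_map_swap ν volume hk fun x t => levelDensity_ne_top w t x

lemma ae_isProbabilityMeasure_heightKernel (hw : Measurable w) :
    ∀ᵐ x ∂ν.withDensity fun x => ENNReal.ofReal (w x),
      IsProbabilityMeasure (heightKernel w x) := by
  rw [ae_withDensity_iff hw.ennreal_ofReal]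
  refine ae_of_all _ fun x hx => ?_
  rw [heightKernel_apply hw]
  exact isProbabilityMeasure_normalized (by simpa using hx) (by simp)

end Slice

/-- Euclidean space of dimension `d`. -/
abbrev Space (d : ℕ) : Type := EuclideanSpace ℝ (Fin d)

/-- The unit sphere of directions. -/
abbrev Direction (d : ℕ) : Type := Metric.sphere (0 : Space d) 1

section Line

variable {d : ℕ} (x : Space d) (θ : Direction d)

lemma lintegral_lineMeasure {F : Space d → ℝ≥0∞} (hF : Measurable F) :
    ∫⁻ z, F z ∂lineMeasure x θ = ∫⁻ s : ℝ, F (x + s • (θ : Space d)) := by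
  rw [lineMeasure, lintegral_map hF (by fun_prop)]

instance : SFinite (lineMeasure x θ) :=
  inferInstanceAs (SFinite (Measure.map _ _))

lemma lineMeasure_add_smul (s : ℝ) :
    lineMeasure (x + s • (θ : Space d)) θ = lineMeasure x θ := by
  refine Measure.ext_of_lintegral _ fun F hF => ?_
  rw [lintegral_lineMeasure _ _ hF, lintegral_lineMeasure _ _ hF,
    ← lintegral_add_left_eq_self (fun r : ℝ => F (x + r • (θ : Space d))) s]
  simp only [add_smul, add_assoc]

lemma measurableSet_line : MeasurableSet {z : Space d | ∃ s : ℝ, z = x + s • (θ : Space d)} := by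
  have hline : {z : Space d | ∃ s : ℝ, z = x + s • (θ : Space d)} =
      {z | z = x + (inner ℝ (z - x) (θ : Space d)) • (θ : Space d)} := by
    ext z
    refine ⟨?_, fun h => ⟨_, h⟩⟩
    rintro ⟨s, rfl⟩
    simp [inner_smul_left]
  rw [hline]
  exact measurableSet_eq_fun (by fun_prop) (by fun_prop)

lemma ae_lineMeasure : ∀ᵐ z ∂lineMeasure x θ, ∃ s : ℝ, z = x + s • (θ : Space d) := by
  rw [lineMeasure, ae_map_iff (by fun_prop) (measurableSet_line x θ)]
  exact ae_of_all _ fun s => ⟨s, rfl⟩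

lemma restrict_chord_lineMeasure (G : Set (Space d)) :
    (lineMeasure x θ).restrict (chord G x θ) = (lineMeasure x θ).restrict G := by
  refine Measure.restrict_congr_set ?_
  filter_upwards [ae_lineMeasure x θ] with z hz
  exact propext ⟨fun h => h.1, fun h => ⟨h, hz⟩⟩

/-- The total mass of the density `h` on the line through `x` in direction `θ`. -/
noncomputable def chordMass (h : Space d → ℝ≥0∞) (θ : Direction d) (x : Space d) : ℝ≥0∞ :=
  ∫⁻ z, h z ∂lineMeasure x θ

variable (d) in
/-- The kernel `(x, θ) ↦ lineMeasure x θ`. -/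
noncomputable def lineKernel : Kernel (Space d × Direction d) (Space d) :=
  (Kernel.id ×ₖ Kernel.const _ volume).map
    fun p : (Space d × Direction d) × ℝ => p.1.1 + p.2 • (p.1.2 : Space d)

instance : IsSFiniteKernel (lineKernel d) :=
  inferInstanceAs (IsSFiniteKernel (Kernel.map _ _))

lemma lineKernel_apply (p : Space d × Direction d) : lineKernel d p = lineMeasure p.1 p.2 := by
  rw [lineKernel, Kernel.map_apply _ (by fun_prop), Kernel.prod_apply, Kernel.id_apply,
    Kernel.const_apply, Measure.dirac_prod, Measure.map_map (by fun_prop) (by fun_prop)]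
  rfl

end Line

section Chord

variable {d : ℕ} {h : Space d → ℝ≥0∞} (θ : Direction d)

lemma lintegral_lineMeasure_swap {Φ : Space d → Space d → ℝ≥0∞}
    (hΦ : Measurable (Function.uncurry Φ)) :
    ∫⁻ x, ∫⁻ z, Φ x z ∂lineMeasure x θ = ∫⁻ x, ∫⁻ z, Φ z x ∂lineMeasure x θ := by
  have hline (x : Space d) : ∫⁻ z, Φ x z ∂lineMeasure x θ =
      ∫⁻ s : ℝ, Φ x (x + s • (θ : Space d)) := lintegral_lineMeasure x θ (by fun_prop)
  have hline' (x : Space d) : ∫⁻ z, Φ z x ∂lineMeasure x θ =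
      ∫⁻ s : ℝ, Φ (x + s • (θ : Space d)) x := lintegral_lineMeasure x θ (by fun_prop)
  have hmeas : Measurable fun s : ℝ => ∫⁻ x, Φ (x + s • (θ : Space d)) x :=
    Measurable.lintegral_prod_right' (f := fun p : ℝ × Space d => Φ (p.2 + p.1 • (θ : Space d)) p.2)
      (by fun_prop)
  simp_rw [hline, hline']
  calc ∫⁻ x, ∫⁻ s : ℝ, Φ x (x + s • (θ : Space d))
      = ∫⁻ s : ℝ, ∫⁻ x, Φ x (x + s • (θ : Space d)) :=
        lintegral_lintegral_swap (by fun_prop)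
    _ = ∫⁻ s : ℝ, ∫⁻ x, Φ (x + (-s) • (θ : Space d)) x := by
        refine lintegral_congr fun s => ?_
        rw [← lintegral_add_right_eq_self (fun x => Φ (x + (-s) • (θ : Space d)) x)
          (s • (θ : Space d))]
        simp
    _ = ∫⁻ s : ℝ, ∫⁻ x, Φ (x + s • (θ : Space d)) x :=
        (Measure.measurePreserving_neg (volume : Measure ℝ)).lintegral_comp hmeas
    _ = ∫⁻ x, ∫⁻ s : ℝ, Φ (x + s • (θ : Space d)) x :=
        lintegral_lintegral_swap (by fun_prop)

lemma measurable_chordMass (hh : Measurable h) : Measurable (chordMass h θ) := by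
  have hmeas := hh.lintegral_kernel (κ := (lineKernel d).sectL θ)
  simp only [Kernel.sectL_apply, lineKernel_apply] at hmeas
  exact hmeas

/-- The Gaussian weight along `θ` replaces a change to coordinates adapted to `θ`. -/
lemma lintegral_gaussianPDF_mul_chordMass (hh : Measurable h) :
    ∫⁻ x, gaussianPDF 0 1 (inner ℝ x (θ : Space d)) * chordMass h θ x = ∫⁻ x, h x := by
  have := measurable_gaussianPDF 0 1
  have hinner (x : Space d) (s : ℝ) :
      inner ℝ (x + s • (θ : Space d)) (θ : Space d) = inner ℝ x (θ : Space d) + s := by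
    simp [inner_add_left, inner_smul_left]
  calc ∫⁻ x, gaussianPDF 0 1 (inner ℝ x (θ : Space d)) * chordMass h θ x
      = ∫⁻ x, ∫⁻ z, gaussianPDF 0 1 (inner ℝ x (θ : Space d)) * h z ∂lineMeasure x θ :=
        lintegral_congr fun x => (lintegral_const_mul _ hh).symm
    _ = ∫⁻ x, ∫⁻ z, gaussianPDF 0 1 (inner ℝ z (θ : Space d)) * h x ∂lineMeasure x θ :=
        lintegral_lineMeasure_swap θ (by fun_prop)
    _ = ∫⁻ x, h x := by
        refine lintegral_congr fun x => ?_
        rw [lintegral_lineMeasure x θ (by fun_prop), lintegral_mul_const _ (by fun_prop)]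
        simp_rw [hinner]
        rw [lintegral_add_left_eq_self (gaussianPDF 0 1),
          lintegral_gaussianPDF_eq_one 0 one_ne_zero, one_mul]

lemma ae_chordMass_ne_top (hh : Measurable h) (hfin : ∫⁻ x, h x ≠ ∞) :
    ∀ᵐ x, chordMass h θ x ≠ ∞ := by
  have hweight : Measurable fun x : Space d => gaussianPDF 0 1 (inner ℝ x (θ : Space d)) :=
    (measurable_gaussianPDF 0 1).comp (by fun_prop)
  rw [← lintegral_gaussianPDF_mul_chordMass θ hh] at hfin
  filter_upwards [ae_lt_top (hweight.mul (measurable_chordMass θ hh)) hfin] with x hx hxtop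
  rw [Pi.mul_apply, hxtop, ENNReal.mul_top (gaussianPDF_pos 0 one_ne_zero _).ne'] at hx
  exact hx.false

lemma ae_chordMass_ne_zero (hh : Measurable h) :
    ∀ᵐ x ∂volume.withDensity h, chordMass h θ x ≠ 0 := by
  set N : Set (Space d) := {x | chordMass h θ x = 0} with hN
  have hNm : MeasurableSet N := measurable_chordMass θ hh (measurableSet_singleton 0)
  have hmass (x : Space d) : chordMass (N.indicator h) θ x = 0 := by
    by_cases hx : x ∈ N
    · exact le_antisymm ((lintegral_mono (indicator_le_self N h)).trans_eq hx) zero_le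
    · refine lintegral_eq_zero_of_ae_eq_zero ?_
      filter_upwards [ae_lineMeasure x θ] with z ⟨s, hz⟩
      refine indicator_of_notMem (fun hzN => hx ?_) h
      rwa [hN, mem_ofPred_eq, hz, chordMass, lineMeasure_add_smul] at hzN
  have hzero : ∫⁻ x, N.indicator h x = 0 := by
    simp [← lintegral_gaussianPDF_mul_chordMass θ (hh.indicator hNm), hmass]
  rw [lintegral_indicator hNm, ← withDensity_apply _ hNm] at hzero
  exact measure_eq_zero_iff_ae_notMem.1 hzero

/-- The unnormalized kernel which from `x` moves along the line in direction `θ` with density `h`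
with respect to the length. -/
noncomputable def lineDensityKernel (θ : Direction d) (h : Space d → ℝ≥0∞) :
    Kernel (Space d) (Space d) :=
  ((lineKernel d).sectL θ).withDensity fun _ => h

lemma lineDensityKernel_apply (hh : Measurable h) (x : Space d) :
    lineDensityKernel θ h x = (lineMeasure x θ).withDensity h := by
  have hh' : Measurable (Function.uncurry fun _ : Space d => h) := hh.comp measurable_snd
  rw [lineDensityKernel, Kernel.withDensity_apply _ hh', Kernel.sectL_apply, lineKernel_apply]

lemma lineDensityKernel_apply_univ (hh : Measurable h) (x : Space d) :
    lineDensityKernel θ h x univ = chordMass h θ x := by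
  rw [lineDensityKernel_apply θ hh, withDensity_apply _ MeasurableSet.univ, Measure.restrict_univ,
    chordMass]

lemma lineDensityKernel_add_smul (hh : Measurable h) (x : Space d) (s : ℝ) :
    lineDensityKernel θ h (x + s • (θ : Space d)) = lineDensityKernel θ h x := by
  rw [lineDensityKernel_apply θ hh, lineDensityKernel_apply θ hh, lineMeasure_add_smul]

lemma ae_normalizedKernel_lineDensityKernel (hh : Measurable h) (x : Space d) :
    ∀ᵐ z ∂normalizedKernel (lineDensityKernel θ h) x, ∃ s : ℝ, z = x + s • (θ : Space d) := by
  rw [normalizedKernel_apply, lineDensityKernel_apply θ hh]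
  exact Measure.ae_smul_measure
    ((withDensity_absolutelyContinuous _ _).ae_le (ae_lineMeasure x θ)) _

lemma isReversible_lineDensityKernel (hh : Measurable h) :
    (lineDensityKernel θ h).IsReversible (volume.withDensity h) := by
  have hflow {A B : Set (Space d)} (hA : MeasurableSet A) (hB : MeasurableSet B) :
      ∫⁻ x in A, lineDensityKernel θ h x B ∂volume.withDensity h =
        ∫⁻ x, ∫⁻ z, A.indicator h x * B.indicator h z ∂lineMeasure x θ := by
    rw [← lintegral_indicator hA, lintegral_withDensity_eq_lintegral_mul _ hh
      (((lineDensityKernel θ h).measurable_coe hB).indicator hA)]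
    refine lintegral_congr fun x => ?_
    rw [lintegral_const_mul _ (hh.indicator hB), Pi.mul_apply, lintegral_indicator hB,
      ← withDensity_apply _ hB, ← lineDensityKernel_apply θ hh]
    by_cases hx : x ∈ A <;> simp [hx]
  intro A B hA hB
  have hΦ : Measurable (Function.uncurry fun x z => A.indicator h x * B.indicator h z) :=
    ((hh.indicator hA).comp measurable_fst).mul ((hh.indicator hB).comp measurable_snd)
  rw [hflow hA hB, hflow hB hA, lintegral_lineMeasure_swap θ hΦ]
  simp_rw [mul_comm]

lemma isAveraging_normalizedKernel_lineDensityKernel (hh : Measurable h) (hfin : ∫⁻ x, h x ≠ ∞) :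
    IsAveraging (volume.withDensity h) (normalizedKernel (lineDensityKernel θ h)) := by
  refine isAveraging_normalizedKernel (isReversible_lineDensityKernel θ hh) (fun x => ?_) ?_ ?_
  · have hline : ∀ᵐ z ∂lineDensityKernel θ h x, ∃ s : ℝ, z = x + s • (θ : Space d) := by
      rw [lineDensityKernel_apply θ hh]
      exact (withDensity_absolutelyContinuous _ _).ae_le (ae_lineMeasure x θ)
    filter_upwards [hline] with z ⟨s, hz⟩
    rw [hz, lineDensityKernel_add_smul θ hh]
  · simpa only [lineDensityKernel_apply_univ θ hh] using ae_chordMass_ne_zero θ hh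
  · simp only [lineDensityKernel_apply_univ θ hh]
    exact (withDensity_absolutelyContinuous _ _).ae_le (ae_chordMass_ne_top θ hh hfin)

variable {β : Type*} [MeasurableSpace β] {θ : β → Direction d} {H : β → Space d → ℝ≥0∞}

/-- The kernel which moves from `(x, b)` to a random point of the line through `x` in direction
`θ b`, drawn from the distribution proportional to the density `H b`. -/
noncomputable def chordKernel (hθ : Measurable θ) (H : β → Space d → ℝ≥0∞) :
    Kernel (Space d × β) (Space d) :=
  normalizedKernel (((lineKernel d).comap (Prod.map id θ) (measurable_id.prodMap hθ)).withDensity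
    fun p => H p.2)

instance (hθ : Measurable θ) : IsSubMarkovKernel (chordKernel hθ H) :=
  inferInstanceAs (IsSubMarkovKernel (normalizedKernel _))

lemma chordKernel_apply (hθ : Measurable θ) (hH : Measurable (Function.uncurry H))
    (p : Space d × β) :
    chordKernel hθ H p = normalized ((lineMeasure p.1 (θ p.2)).withDensity (H p.2)) := by
  have hH' : Measurable (Function.uncurry fun (p : Space d × β) => H p.2) :=
    hH.comp (measurable_fst.snd.prodMk measurable_snd)
  rw [chordKernel, normalizedKernel_apply, Kernel.withDensity_apply _ hH', Kernel.comap_apply,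
    lineKernel_apply]
  rfl

lemma sectL_chordKernel (hθ : Measurable θ) (hH : Measurable (Function.uncurry H)) (b : β) :
    (chordKernel hθ H).sectL b = normalizedKernel (lineDensityKernel (θ b) (H b)) := by
  ext1 x
  rw [Kernel.sectL_apply, chordKernel_apply hθ hH, normalizedKernel_apply,
    lineDensityKernel_apply _ hH.of_uncurry_left]

end Chord

section LevelWalk

variable {α : Type*} [MeasurableSpace α] {ν : Measure α} [SFinite ν] {w : α → ℝ} {k : α → α → ℝ≥0}

/-- The kernel which from `(x, t)` proposes a point with density `k x` and moves there if that
point lies in the level set of `w` at height `t`; mass is lost when the proposal is rejected. -/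
noncomputable def levelWalk (ν : Measure α) [SFinite ν] (w : α → ℝ) (k : α → α → ℝ≥0) :
    Kernel (α × ℝ) α :=
  (Kernel.const _ ν).withDensity fun p y => levelDensity w p.2 y * k p.1 y

instance : IsSFiniteKernel (levelWalk ν w k) :=
  Kernel.IsSFiniteKernel.withDensity _ fun p y =>
    ENNReal.mul_ne_top (levelDensity_ne_top w p.2 y) ENNReal.coe_ne_top

lemma lintegral_levelWalk (hw : Measurable w) (hk : Measurable (Function.uncurry k))
    (p : α × ℝ) {F : α → ℝ≥0∞} (hF : Measurable F) :
    ∫⁻ y, F y ∂levelWalk ν w k p = ∫⁻ y, levelDensity w p.2 y * k p.1 y * F y ∂ν := by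
  have hL := measurable_levelDensity hw
  refine Kernel.lintegral_withDensity (Kernel.const _ ν) ?_ p hF
  exact (hL.comp (measurable_fst.snd.prodMk measurable_snd)).mul
    (hk.comp (measurable_fst.fst.prodMk measurable_snd)).coe_nnreal_ennreal

lemma isSubMarkovKernel_levelWalk (hw : Measurable w) (hk : Measurable (Function.uncurry k))
    (hk1 : ∀ x, ∫⁻ y, k x y ∂ν ≤ 1) : IsSubMarkovKernel (levelWalk ν w k) where
  measure_univ_le_one p := by
    calc levelWalk ν w k p univ = ∫⁻ y, levelDensity w p.2 y * k p.1 y ∂ν := by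
          simpa using lintegral_levelWalk (ν := ν) hw hk p measurable_one
      _ ≤ ∫⁻ y, k p.1 y ∂ν :=
          lintegral_mono fun y => mul_le_of_le_one_left' (levelDensity_le_one w p.2 y)
      _ ≤ 1 := hk1 p.1

lemma isReversible_sectL_levelWalk (hw : Measurable w) (hk : Measurable (Function.uncurry k))
    (hk_symm : ∀ x y, k x y = k y x) (t : ℝ) :
    ((levelWalk ν w k).sectL t).IsReversible (levelKernel ν w t) := by
  have hL : Measurable (levelDensity w t) := (measurable_levelDensity hw).of_uncurry_left
  have hflow {A B : Set α} (hA : MeasurableSet A) (hB : MeasurableSet B) :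
      ∫⁻ x in A, (levelWalk ν w k).sectL t x B ∂levelKernel ν w t =
        ∫⁻ x, ∫⁻ y, A.indicator (levelDensity w t) x * B.indicator (levelDensity w t) y *
          k x y ∂ν ∂ν := by
    rw [levelKernel_apply hw, ← lintegral_indicator hA, lintegral_withDensity_eq_lintegral_mul _ hL
      ((((levelWalk ν w k).sectL t).measurable_coe hB).indicator hA)]
    refine lintegral_congr fun x => ?_
    have hmass : (levelWalk ν w k).sectL t x B =
        ∫⁻ y, B.indicator (levelDensity w t) y * k x y ∂ν := by
      rw [Kernel.sectL_apply, ← lintegral_indicator_one hB,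
        lintegral_levelWalk hw hk _ (measurable_one.indicator hB)]
      refine lintegral_congr fun y => ?_
      by_cases hy : y ∈ B <;> simp [hy]
    simp_rw [mul_assoc]
    rw [lintegral_const_mul _ (by fun_prop), ← hmass, Pi.mul_apply]
    by_cases hx : x ∈ A <;> simp [hx]
  intro A B hA hB
  have hmeas : Measurable fun p : α × α => A.indicator (levelDensity w t) p.1 *
      B.indicator (levelDensity w t) p.2 * k p.1 p.2 :=
    (((hL.indicator hA).comp measurable_fst).mul ((hL.indicator hB).comp measurable_snd)).mul
      hk.coe_nnreal_ennreal
  rw [hflow hA hB, hflow hB hA, lintegral_lintegral_swap hmeas.aemeasurable]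
  refine lintegral_congr fun y => lintegral_congr fun x => ?_
  rw [hk_symm x y, mul_comm (A.indicator _ x)]

lemma mixture_levelWalk_apply (hw : Measurable w) (hk : Measurable (Function.uncurry k)) (x : α) :
    mixture (heightKernel w) (levelWalk ν w k) x =
      ν.withDensity fun y => heightKernel w x (Ioo 0 (w y)) * k x y := by
  have hL := measurable_levelDensity hw
  have hmass (y : α) :
      heightKernel w x (Ioo 0 (w y)) = ∫⁻ t, levelDensity w t y ∂heightKernel w x :=
    (lintegral_indicator_one measurableSet_Ioo).symm
  have hLt (y : α) : Measurable fun t => levelDensity w t y := hL.of_uncurry_right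
  have hmeas : Measurable fun y => ∫⁻ t, levelDensity w t y ∂heightKernel w x :=
    Measurable.lintegral_prod_right' (f := fun p : α × ℝ => levelDensity w p.2 p.1)
      (hL.comp measurable_swap)
  have hprod : Measurable fun y => (∫⁻ t, levelDensity w t y ∂heightKernel w x) * (k x y : ℝ≥0∞) :=
    hmeas.mul hk.of_uncurry_left.coe_nnreal_ennreal
  refine Measure.ext_of_lintegral _ fun F hF => ?_
  calc ∫⁻ y, F y ∂mixture (heightKernel w) (levelWalk ν w k) x
      = ∫⁻ t, ∫⁻ y, levelDensity w t y * k x y * F y ∂ν ∂heightKernel w x := by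
        rw [lintegral_mixture x hF]
        exact lintegral_congr fun t => lintegral_levelWalk hw hk _ hF
    _ = ∫⁻ y, ∫⁻ t, levelDensity w t y * k x y * F y ∂heightKernel w x ∂ν :=
        lintegral_lintegral_swap (by fun_prop)
    _ = ∫⁻ y, F y ∂ν.withDensity fun y => heightKernel w x (Ioo 0 (w y)) * k x y := by
        simp_rw [hmass]
        rw [lintegral_withDensity_eq_lintegral_mul _ hprod hF]
        refine lintegral_congr fun y => ?_
        rw [lintegral_mul_const _ (by fun_prop), lintegral_mul_const _ (hLt y), Pi.mul_apply]

end LevelWalk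

section Polar

variable {d : ℕ}

instance : IsFiniteMeasure (sphereUniform d) :=
  inferInstanceAs (IsFiniteMeasure (normalized _))

lemma toSphere_univ_ne_zero (hd : 0 < d) : (volume : Measure (Space d)).toSphere univ ≠ 0 := by
  have : NeZero d := ⟨hd.ne'⟩
  rw [Ne, Measure.measure_univ_eq_zero]
  exact Measure.toSphere_ne_zero _

lemma isProbabilityMeasure_sphereUniform (hd : 0 < d) : IsProbabilityMeasure (sphereUniform d) :=
  isProbabilityMeasure_normalized (toSphere_univ_ne_zero hd) (measure_ne_top _ _)

/-- The radial weight of Lebesgue measure in polar coordinates, relative to the uniform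
distribution on the sphere: `r ^ (d - 1)` times the area of the sphere. -/
noncomputable def radialMeasure (d : ℕ) : Measure (Ioi (0 : ℝ)) :=
  (volume : Measure (Space d)).toSphere univ • Measure.volumeIoiPow (d - 1)

lemma lintegral_polar (hd : 0 < d) {F : Space d → ℝ≥0∞} (hF : Measurable F) :
    ∫⁻ z, F z = ∫⁻ θ, ∫⁻ r, F ((r : ℝ) • (θ : Space d)) ∂radialMeasure d ∂sphereUniform d := by
  have : NeZero d := ⟨hd.ne'⟩
  have hpolar : Measurable fun p : Direction d × Ioi (0 : ℝ) =>
      F ((p.2 : ℝ) • (p.1 : Space d)) := by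
    fun_prop
  have hinv (z : ({0}ᶜ : Set (Space d))) :
      ((homeomorphUnitSphereProd (Space d) z).2 : ℝ) •
        ((homeomorphUnitSphereProd (Space d) z).1 : Space d) = z :=
    congrArg Subtype.val ((homeomorphUnitSphereProd (Space d)).symm_apply_apply z)
  calc ∫⁻ z, F z = ∫⁻ z : ({0}ᶜ : Set (Space d)), F z ∂volume.comap Subtype.val := by
        rw [lintegral_subtype_comap (measurableSet_singleton (0 : Space d)).compl,
          restrict_compl_singleton]
    _ = ∫⁻ θ, ∫⁻ r, F ((r : ℝ) • (θ : Space d)) ∂Measure.volumeIoiPow (d - 1)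
          ∂(volume : Measure (Space d)).toSphere := by
        have h :=
          (volume : Measure (Space d)).measurePreserving_homeomorphUnitSphereProd.lintegral_comp
            hpolar
        rw [lintegral_prod _ hpolar.aemeasurable, finrank_euclideanSpace_fin] at h
        simpa only [hinv] using h
    _ = _ := by
        simp_rw [radialMeasure, lintegral_smul_measure, smul_eq_mul]
        rw [lintegral_const_mul' _ _ (measure_ne_top _ _), sphereUniform, lintegral_normalized,
          ← mul_assoc, ENNReal.mul_inv_cancel (toSphere_univ_ne_zero hd) (measure_ne_top _ _),
          one_mul]

namespace IsRotInvDensity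

variable {q : Space d → ℝ}

lemma lintegral_eq_one (hq : IsRotInvDensity q) : ∫⁻ z, ENNReal.ofReal (q z) = 1 := by
  have hint : Integrable q := by
    by_contra h
    simpa [integral_undef h] using hq.integral_eq_one
  rw [← ofReal_integral_eq_lintegral_ofReal hint (ae_of_all _ hq.nonneg), hq.integral_eq_one,
    ENNReal.ofReal_one]

lemma apply_neg (hq : IsRotInvDensity q) (z : Space d) : q (-z) = q z := by
  rcases eq_or_ne z 0 with rfl | hz
  · rw [neg_zero]
  · have hθ : ‖z‖⁻¹ • z ∈ Metric.sphere (0 : Space d) 1 := by simp [norm_smul, hz]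
    simpa [smul_smul, hz] using hq.rotInv ‖z‖ (-⟨_, hθ⟩) ⟨_, hθ⟩

lemma lintegral_radialMeasure (hq : IsRotInvDensity q) (hd : 0 < d) (θ : Direction d) :
    ∫⁻ r, ENNReal.ofReal (q ((r : ℝ) • (θ : Space d))) ∂radialMeasure d = 1 := by
  have := isProbabilityMeasure_sphereUniform hd
  have h := lintegral_polar hd hq.measurable.ennreal_ofReal
  simp_rw [hq.lintegral_eq_one, fun (r : Ioi (0 : ℝ)) θ' => hq.rotInv r θ' θ] at h
  simpa using h.symm

lemma lintegral_mul_le (hq : IsRotInvDensity q) (hd : 0 < d) {J : Space d → ℝ≥0∞}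
    (hJ : Measurable J) {C : Direction d → ℝ≥0∞}
    (hJC : ∀ (r : ℝ) (θ : Direction d), J (r • (θ : Space d)) ≤ C θ) :
    ∫⁻ z, ENNReal.ofReal (q z) * J z ≤ ∫⁻ θ, C θ ∂sphereUniform d := by
  have hqm : Measurable q := hq.measurable
  rw [lintegral_polar hd (by fun_prop)]
  refine lintegral_mono fun θ => ?_
  calc ∫⁻ r, ENNReal.ofReal (q ((r : ℝ) • (θ : Space d))) * J ((r : ℝ) • (θ : Space d))
          ∂radialMeasure d
      ≤ ∫⁻ r, ENNReal.ofReal (q ((r : ℝ) • (θ : Space d))) * C θ ∂radialMeasure d :=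
        lintegral_mono fun r => by gcongr; exact hJC r θ
    _ = C θ := by
        rw [lintegral_mul_const _ (by fun_prop), hq.lintegral_radialMeasure hd θ, one_mul]

end IsRotInvDensity

end Polar

section Displacement

lemma enorm_sub_sq_le (a b c : ℝ) : ‖a - b‖ₑ ^ 2 ≤ 2 * (‖a - c‖ₑ ^ 2 + ‖b - c‖ₑ ^ 2) := by
  simp only [enorm_eq_nnnorm]
  norm_cast
  calc ‖a - b‖₊ ^ 2 ≤ (‖a - c‖₊ + ‖b - c‖₊) ^ 2 := by
        gcongr
        rw [← sub_sub_sub_cancel_right a b c]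
        exact nnnorm_sub_le _ _
    _ ≤ 2 * (‖a - c‖₊ ^ 2 + ‖b - c‖₊ ^ 2) := add_sq_le

lemma lintegral_mul_enorm_sub_add_le {G : Type*} [AddGroup G] [MeasurableSpace G] [MeasurableAdd G]
    (ν : Measure G) [ν.IsAddRightInvariant] {L : G → ℝ≥0∞} {f g : G → ℝ} (hL : Measurable L)
    (hL1 : ∀ x, L x ≤ 1) (hf : Measurable f) (hg : Measurable g) {v : G}
    (hgv : ∀ x, g (x + v) = g x) :
    ∫⁻ x, L x * (L (x + v) * ‖f x - f (x + v)‖ₑ ^ 2) ∂ν ≤ 4 * ∫⁻ x, L x * ‖f x - g x‖ₑ ^ 2 ∂ν := by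
  set E : G → ℝ≥0∞ := fun x => L x * ‖f x - g x‖ₑ ^ 2 with hE
  have hpoint (x : G) : L x * (L (x + v) * ‖f x - f (x + v)‖ₑ ^ 2) ≤ 2 * (E x + E (x + v)) := by
    calc L x * (L (x + v) * ‖f x - f (x + v)‖ₑ ^ 2)
        ≤ L x * (L (x + v) * (2 * (‖f x - g x‖ₑ ^ 2 + ‖f (x + v) - g x‖ₑ ^ 2))) := by
          gcongr
          exact enorm_sub_sq_le _ _ _
      _ = 2 * (L (x + v) * E x + L x * E (x + v)) := by
          simp only [hE, hgv]
          ring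
      _ ≤ 2 * (E x + E (x + v)) := by
          gcongr
          · exact mul_le_of_le_one_left' (hL1 _)
          · exact mul_le_of_le_one_left' (hL1 _)
  have hEm : Measurable E := hL.mul (by fun_prop)
  calc ∫⁻ x, L x * (L (x + v) * ‖f x - f (x + v)‖ₑ ^ 2) ∂ν
      ≤ ∫⁻ x, 2 * (E x + E (x + v)) ∂ν := lintegral_mono hpoint
    _ = 2 * (∫⁻ x, E x ∂ν + ∫⁻ x, E x ∂ν) := by
        rw [lintegral_const_mul' _ _ (by simp), lintegral_add_left hEm,
          lintegral_add_right_eq_self E v]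
    _ = 4 * ∫⁻ x, E x ∂ν := by
        ring

variable {d : ℕ} {q : Space d → ℝ}

/-- The density of an accepted proposal of the lazy random walk with step density `q`: half of
`q (y - x)`. -/
noncomputable def lazyStep (q : Space d → ℝ) (x y : Space d) : ℝ≥0 :=
  (1 / 2 * q (y - x)).toNNReal

lemma measurable_lazyStep (hq : Measurable q) : Measurable (Function.uncurry (lazyStep q)) := by
  unfold lazyStep Function.uncurry
  fun_prop

lemma coe_lazyStep (x y : Space d) :
    (lazyStep q x y : ℝ≥0∞) = 2⁻¹ * ENNReal.ofReal (q (y - x)) := by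
  change ENNReal.ofReal (1 / 2 * q (y - x)) = _
  rw [ENNReal.ofReal_mul (by norm_num)]
  simp [ENNReal.ofReal_inv_of_pos]

lemma IsRotInvDensity.lazyStep_comm (hq : IsRotInvDensity q) (x y : Space d) :
    lazyStep q x y = lazyStep q y x := by
  rw [lazyStep, lazyStep, ← hq.apply_neg, neg_sub]

lemma IsRotInvDensity.lintegral_lazyStep_le_one (hq : IsRotInvDensity q) (x : Space d) :
    ∫⁻ y, lazyStep q x y ≤ 1 := by
  simp_rw [coe_lazyStep]
  rw [lintegral_const_mul' _ _ (by simp),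
    lintegral_sub_right_eq_self (fun z => ENNReal.ofReal (q z)) x, hq.lintegral_eq_one, mul_one]
  exact ENNReal.inv_le_one.2 one_le_two

lemma lintegral_lintegral_lazyStep (hq : Measurable q) {L : Space d → ℝ≥0∞} {f : Space d → ℝ}
    (hL : Measurable L) (hf : Measurable f) :
    ∫⁻ x, ∫⁻ y, L y * lazyStep q x y * ‖f x - f y‖ₑ ^ 2 ∂volume ∂volume.withDensity L =
      ∫⁻ z, ENNReal.ofReal (q z) *
        (2⁻¹ * ∫⁻ x, L x * (L (x + z) * ‖f x - f (x + z)‖ₑ ^ 2)) := by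
  have hstep := measurable_lazyStep hq
  have hmeas : Measurable fun x => ∫⁻ y, L y * lazyStep q x y * ‖f x - f y‖ₑ ^ 2 :=
    Measurable.lintegral_prod_right' (f := fun p : Space d × Space d =>
      L p.2 * lazyStep q p.1 p.2 * ‖f p.1 - f p.2‖ₑ ^ 2) (by fun_prop)
  have hinner (x : Space d) : ∫⁻ y, L y * lazyStep q x y * ‖f x - f y‖ₑ ^ 2 =
      ∫⁻ z, L (x + z) * (2⁻¹ * ENNReal.ofReal (q z)) * ‖f x - f (x + z)‖ₑ ^ 2 := by
    rw [← lintegral_add_left_eq_self _ x]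
    simp_rw [coe_lazyStep, add_sub_cancel_left]
  calc ∫⁻ x, ∫⁻ y, L y * lazyStep q x y * ‖f x - f y‖ₑ ^ 2 ∂volume ∂volume.withDensity L
      = ∫⁻ x, ∫⁻ z, L x * (L (x + z) * (2⁻¹ * ENNReal.ofReal (q z)) * ‖f x - f (x + z)‖ₑ ^ 2) := by
        rw [lintegral_withDensity_eq_lintegral_mul _ hL hmeas]
        refine lintegral_congr fun x => ?_
        rw [Pi.mul_apply, hinner, lintegral_const_mul _ (by fun_prop)]
    _ = ∫⁻ z, ∫⁻ x, L x * (L (x + z) * (2⁻¹ * ENNReal.ofReal (q z)) * ‖f x - f (x + z)‖ₑ ^ 2) :=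
        lintegral_lintegral_swap (by fun_prop)
    _ = _ := by
        refine lintegral_congr fun z => ?_
        rw [← lintegral_const_mul _ (by fun_prop), ← lintegral_const_mul _ (by fun_prop)]
        refine lintegral_congr fun x => ?_
        ring

/-- Conditionally on its direction `θ`, the step moves along a line on which the mean of `f` is the
same at both ends, so the triangle inequality bounds the squared increment of `f` by four squared
distances to that mean, of which the laziness removes half. -/
lemma IsRotInvDensity.lintegral_lazyStep_le (hq : IsRotInvDensity q) (hd : 0 < d)
    {L : Space d → ℝ≥0∞} (hL : Measurable L) (hL1 : ∀ x, L x ≤ 1) (hfin : ∫⁻ x, L x ≠ ∞)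
    {f : Space d → ℝ} (hf : Measurable f) :
    ∫⁻ x, ∫⁻ y, L y * lazyStep q x y * ‖f x - f y‖ₑ ^ 2 ∂volume ∂volume.withDensity L ≤
      ∫⁻ θ, dirichletForm (volume.withDensity L) (normalizedKernel (lineDensityKernel θ L)) f
        ∂sphereUniform d := by
  have hJ : Measurable fun z => 2⁻¹ * ∫⁻ x, L x * (L (x + z) * ‖f x - f (x + z)‖ₑ ^ 2) :=
    (Measurable.lintegral_prod_right' (f := fun p : Space d × Space d =>
      L p.2 * (L (p.2 + p.1) * ‖f p.2 - f (p.2 + p.1)‖ₑ ^ 2)) (by fun_prop)).const_mul _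
  rw [lintegral_lintegral_lazyStep hq.measurable hL hf]
  refine hq.lintegral_mul_le hd hJ fun r θ => ?_
  have := isFiniteMeasure_withDensity hfin
  set κ := normalizedKernel (lineDensityKernel θ L) with hκ
  have hg : Measurable fun x => ∫ y, f y ∂κ x := hf.stronglyMeasurable.integral_kernel.measurable
  have hgθ (x : Space d) : ∫ y, f y ∂κ (x + r • (θ : Space d)) = ∫ y, f y ∂κ x := by
    rw [hκ, normalizedKernel_apply, normalizedKernel_apply, lineDensityKernel_add_smul θ hL]
  calc 2⁻¹ * ∫⁻ x, L x * (L (x + r • (θ : Space d)) * ‖f x - f (x + r • (θ : Space d))‖ₑ ^ 2)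
      ≤ 2⁻¹ * (4 * ∫⁻ x, L x * ‖f x - ∫ y, f y ∂κ x‖ₑ ^ 2) := by
        gcongr
        exact lintegral_mul_enorm_sub_add_le volume hL hL1 hf hg hgθ
    _ = 2 * ∫⁻ x, ‖f x - ∫ y, f y ∂κ x‖ₑ ^ 2 ∂volume.withDensity L := by
        rw [lintegral_withDensity_eq_lintegral_mul _ hL (by fun_prop), ← mul_assoc,
          show (4 : ℝ≥0∞) = 2 * 2 by norm_num, ← mul_assoc,
          ENNReal.inv_mul_cancel two_ne_zero ENNReal.ofNat_ne_top, one_mul]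
        rfl
    _ = dirichletForm (volume.withDensity L) κ f :=
        ((isAveraging_normalizedKernel_lineDensityKernel θ hL hfin).dirichletForm_eq hf).symm

end Displacement

section SamplerKernel

variable {α : Type*} [MeasurableSpace α] {d : ℕ}

/-- The measure with density `w`, the target distribution before normalization. -/
noncomputable abbrev densityMeasure (ν : Measure α) (w : α → ℝ) : Measure α :=
  ν.withDensity fun x => ENNReal.ofReal (w x)

/-- Conditional resampling along lines inside the level sets of `w`: from `(x, t, θ)`, a uniform
point of the part above height `t` of the line through `x` in direction `θ`. -/
noncomputable def levelChordKernel (w : Space d → ℝ) :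
    Kernel (Space d × (ℝ × Direction d)) (Space d) :=
  chordKernel (measurable_snd : Measurable fun b : ℝ × Direction d => b.2)
    fun b => levelDensity w b.1

/-- The lazy Metropolis kernel. The acceptance step is implemented by a height drawn from
`heightKernel w`: a proposal `y` is accepted if it lies above that height, which has probability
`min 1 (w y / w x)`. -/
noncomputable def metropolisKernel (w q : Space d → ℝ) : Kernel (Space d) (Space d) :=
  fillKernel (mixture (heightKernel w) (levelWalk volume w (lazyStep q)))

/-- The hybrid slice sampler based on hit-and-run, as a kernel. -/
noncomputable def hybridSliceKernel (w : Space d → ℝ) : Kernel (Space d) (Space d) :=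
  mixture (heightKernel w ×ₖ Kernel.const _ (sphereUniform d)) (levelChordKernel w)

/-- The hit-and-run algorithm, as a kernel. -/
noncomputable def hitAndRunKernel (w : Space d → ℝ) : Kernel (Space d) (Space d) :=
  mixture (Kernel.const _ (sphereUniform d))
    (chordKernel measurable_id fun _ x => ENNReal.ofReal (w x))

/-- The simple slice sampler, as a kernel. -/
noncomputable def simpleSliceKernel (ν : Measure α) [SFinite ν] (w : α → ℝ) : Kernel α α :=
  mixture (heightKernel w) ((normalizedKernel (levelKernel ν w)).prodMkLeft α)

instance (w : Space d → ℝ) : IsSubMarkovKernel (levelChordKernel w) :=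
  inferInstanceAs (IsSubMarkovKernel (chordKernel _ _))

instance : IsSubMarkovKernel (Kernel.const α (sphereUniform d)) :=
  ⟨fun _ => normalized_univ_le_one _⟩

instance (w : Space d → ℝ) : IsSubMarkovKernel (hybridSliceKernel w) :=
  inferInstanceAs (IsSubMarkovKernel (mixture _ _))

instance (w : Space d → ℝ) : IsSubMarkovKernel (hitAndRunKernel w) :=
  inferInstanceAs (IsSubMarkovKernel (mixture _ _))

instance (ν : Measure α) [SFinite ν] (w : α → ℝ) :
    IsSubMarkovKernel ((normalizedKernel (levelKernel ν w)).prodMkLeft α) :=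
  ⟨fun p => IsSubMarkovKernel.measure_univ_le_one (κ := normalizedKernel (levelKernel ν w)) p.2⟩

instance (ν : Measure α) [SFinite ν] (w : α → ℝ) : IsSubMarkovKernel (simpleSliceKernel ν w) :=
  inferInstanceAs (IsSubMarkovKernel (mixture _ _))

variable {w q : Space d → ℝ}

lemma IsRotInvDensity.isSubMarkovKernel_metropolisKernel (hq : IsRotInvDensity q)
    (hw : Measurable w) : IsSubMarkovKernel (metropolisKernel w q) := by
  have := isSubMarkovKernel_levelWalk (ν := volume) hw (measurable_lazyStep hq.measurable)
    hq.lintegral_lazyStep_le_one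
  exact inferInstanceAs (IsSubMarkovKernel (fillKernel _))

lemma measurable_uncurry_levelDensity_fst (hw : Measurable w) :
    Measurable (Function.uncurry fun b : ℝ × Direction d => levelDensity w b.1) :=
  (measurable_levelDensity hw).comp (measurable_fst.fst.prodMk measurable_snd)

lemma sectL_levelChordKernel (hw : Measurable w) (b : ℝ × Direction d) :
    (levelChordKernel w).sectL b = normalizedKernel (lineDensityKernel b.2 (levelDensity w b.1)) :=
  sectL_chordKernel measurable_snd (measurable_uncurry_levelDensity_fst hw) b

lemma isAveraging_sectL_levelChordKernel (hw : Measurable w)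
    (hint : ∫⁻ x, ENNReal.ofReal (w x) ≠ ∞) (b : ℝ × Direction d) :
    IsAveraging (levelKernel volume w b.1) ((levelChordKernel w).sectL b) := by
  rw [sectL_levelChordKernel hw, levelKernel_apply hw]
  exact isAveraging_normalizedKernel_lineDensityKernel b.2
    (measurable_levelDensity hw).of_uncurry_left (lintegral_levelDensity_ne_top hint b.1)

lemma sectL_chordKernel_id (hw : Measurable w) (θ : Direction d) :
    (chordKernel measurable_id fun _ x => ENNReal.ofReal (w x)).sectL θ =
      normalizedKernel (lineDensityKernel θ fun x => ENNReal.ofReal (w x)) :=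
  sectL_chordKernel measurable_id (hw.comp measurable_snd).ennreal_ofReal θ

lemma isAveraging_sectL_chordKernel_id (hw : Measurable w)
    (hint : ∫⁻ x, ENNReal.ofReal (w x) ≠ ∞) (θ : Direction d) :
    IsAveraging (densityMeasure volume w)
      ((chordKernel measurable_id fun _ x => ENNReal.ofReal (w x)).sectL θ) := by
  rw [sectL_chordKernel_id hw]
  exact isAveraging_normalizedKernel_lineDensityKernel θ hw.ennreal_ofReal hint

lemma invariant_metropolisKernel (hw : Measurable w) (hq : IsRotInvDensity q) :
    (metropolisKernel w q).Invariant (densityMeasure volume w) := by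
  have hstep := measurable_lazyStep hq.measurable
  have := isSubMarkovKernel_levelWalk (ν := volume) hw hstep hq.lintegral_lazyStep_le_one
  exact invariant_fillKernel (isReversible_mixture (compProd_levelKernel hw)
    (ae_of_all _ (isReversible_sectL_levelWalk hw hstep hq.lazyStep_comm)))

lemma invariant_hybridSliceKernel (hd : 0 < d) (hw : Measurable w)
    (hint : ∫⁻ x, ENNReal.ofReal (w x) ≠ ∞) :
    (hybridSliceKernel w).Invariant (densityMeasure volume w) := by
  have := isProbabilityMeasure_sphereUniform hd
  refine invariant_mixture (compProd_prod_const_eq_map_swap (compProd_levelKernel hw) _) ?_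
    (ae_of_all _ fun b => (isAveraging_sectL_levelChordKernel hw hint b).invariant)
  filter_upwards [ae_isProbabilityMeasure_heightKernel hw] with x hx
  rw [Kernel.prod_apply, Kernel.const_apply]
  infer_instance

lemma invariant_hitAndRunKernel (hd : 0 < d) (hw : Measurable w)
    (hint : ∫⁻ x, ENNReal.ofReal (w x) ≠ ∞) :
    (hitAndRunKernel w).Invariant (densityMeasure volume w) :=
  invariant_mixture (compProd_const_eq_map_swap _ _)
    (ae_of_all _ fun _ => isProbabilityMeasure_sphereUniform hd)
    (ae_of_all _ fun θ => (isAveraging_sectL_chordKernel_id hw hint θ).invariant)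

lemma isFiniteMeasure_levelKernel {ν : Measure α} [SFinite ν] {w : α → ℝ} (hw : Measurable w)
    (hint : ∫⁻ x, ENNReal.ofReal (w x) ∂ν ≠ ∞) (t : ℝ) : IsFiniteMeasure (levelKernel ν w t) := by
  rw [levelKernel_apply hw]
  exact isFiniteMeasure_withDensity (lintegral_levelDensity_ne_top hint t)

lemma isAveraging_sectL_levelKernel {ν : Measure α} [SFinite ν] {w : α → ℝ} (hw : Measurable w)
    (hint : ∫⁻ x, ENNReal.ofReal (w x) ∂ν ≠ ∞) (t : ℝ) :
    IsAveraging (levelKernel ν w t)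
      (((normalizedKernel (levelKernel ν w)).prodMkLeft α).sectL t) := by
  have := isFiniteMeasure_levelKernel hw hint t
  exact isAveraging_const_normalized (levelKernel ν w t)

lemma invariant_simpleSliceKernel {ν : Measure α} [SFinite ν] {w : α → ℝ} (hw : Measurable w)
    (hint : ∫⁻ x, ENNReal.ofReal (w x) ∂ν ≠ ∞) :
    (simpleSliceKernel ν w).Invariant (densityMeasure ν w) :=
  invariant_mixture (compProd_levelKernel hw) (ae_isProbabilityMeasure_heightKernel hw)
    (ae_of_all _ fun t => (isAveraging_sectL_levelKernel hw hint t).invariant)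

variable {f : Space d → ℝ}

lemma dirichletForm_hybridSliceKernel (hw : Measurable w) (hf : Measurable f) :
    dirichletForm (densityMeasure volume w) (hybridSliceKernel w) f =
      ∫⁻ t, ∫⁻ θ, dirichletForm (levelKernel volume w t) ((levelChordKernel w).sectL (t, θ)) f
        ∂sphereUniform d := by
  rw [hybridSliceKernel,
    dirichletForm_mixture (compProd_prod_const_eq_map_swap (compProd_levelKernel hw) _) hf,
    lintegral_prod _ (measurable_dirichletForm_sectL _ _ hf).aemeasurable]
  rfl

lemma dirichletForm_metropolisKernel_le (hd : 0 < d) (hw : Measurable w)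
    (hint : ∫⁻ x, ENNReal.ofReal (w x) ≠ ∞) (hq : IsRotInvDensity q) (hf : Measurable f) :
    dirichletForm (densityMeasure volume w) (metropolisKernel w q) f ≤
      dirichletForm (densityMeasure volume w) (hybridSliceKernel w) f := by
  rw [metropolisKernel, dirichletForm_fillKernel hf,
    dirichletForm_mixture (compProd_levelKernel hw) hf, dirichletForm_hybridSliceKernel hw hf]
  refine lintegral_mono fun t => ?_
  have hstep (x : Space d) := lintegral_levelWalk (ν := volume) hw
    (measurable_lazyStep hq.measurable) (x, t) (F := fun y => ‖f x - f y‖ₑ ^ 2) (by fun_prop)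
  simp_rw [sectL_levelChordKernel hw, levelKernel_apply hw, dirichletForm, Kernel.sectL_apply,
    hstep]
  exact hq.lintegral_lazyStep_le hd (measurable_levelDensity hw).of_uncurry_left
    (levelDensity_le_one w t) (lintegral_levelDensity_ne_top hint t) hf

lemma dirichletForm_hybridSliceKernel_le_simpleSliceKernel (hd : 0 < d) (hw : Measurable w)
    (hint : ∫⁻ x, ENNReal.ofReal (w x) ≠ ∞) (hf : Measurable f) :
    dirichletForm (densityMeasure volume w) (hybridSliceKernel w) f ≤
      dirichletForm (densityMeasure volume w) (simpleSliceKernel volume w) f := by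
  have := isProbabilityMeasure_sphereUniform hd
  rw [dirichletForm_hybridSliceKernel hw hf, simpleSliceKernel,
    dirichletForm_mixture (compProd_levelKernel hw) hf]
  refine lintegral_mono fun t => ?_
  have := isFiniteMeasure_levelKernel hw hint t
  refine (lintegral_mono fun θ =>
    (isAveraging_sectL_levelChordKernel hw hint (t, θ)).dirichletForm_mono
      (isAveraging_sectL_levelKernel hw hint t) hf fun x => ae_of_all _ fun z => rfl).trans ?_
  simp

lemma dirichletForm_hybridSliceKernel_le_hitAndRunKernel (hw : Measurable w)
    (hint : ∫⁻ x, ENNReal.ofReal (w x) ≠ ∞) (hf : Measurable f) :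
    dirichletForm (densityMeasure volume w) (hybridSliceKernel w) f ≤
      dirichletForm (densityMeasure volume w) (hitAndRunKernel w) f := by
  have := isFiniteMeasure_withDensity hint
  have := isFiniteMeasure_levelKernel hw hint
  have hmeas : Measurable fun b : ℝ × Direction d =>
      dirichletForm (levelKernel volume w b.1) ((levelChordKernel w).sectL b) f :=
    measurable_dirichletForm_sectL ((levelKernel volume w).prodMkRight _) _ hf
  rw [dirichletForm_hybridSliceKernel hw hf, lintegral_lintegral_swap hmeas.aemeasurable,
    hitAndRunKernel, dirichletForm_mixture (compProd_const_eq_map_swap _ _) hf]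
  refine lintegral_mono fun θ => lintegral_dirichletForm_le (compProd_levelKernel hw)
    (ae_isProbabilityMeasure_heightKernel hw)
    (fun t => isAveraging_sectL_levelChordKernel hw hint (t, θ))
    (isAveraging_sectL_chordKernel_id hw hint θ) (fun t x => ?_) hf
  rw [sectL_levelChordKernel hw, sectL_chordKernel_id hw]
  filter_upwards [ae_normalizedKernel_lineDensityKernel θ
    (measurable_levelDensity hw).of_uncurry_left x] with z ⟨s, hz⟩
  rw [hz, normalizedKernel_apply, normalizedKernel_apply,
    lineDensityKernel_add_smul θ hw.ennreal_ofReal]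

end SamplerKernel

section Target

variable {d : ℕ} {K : Set (Space d)} {ρ q : Space d → ℝ}

lemma measurableSet_levelSet (hK : MeasurableSet K) (hρ : Measurable ρ) (t : ℝ) :
    MeasurableSet (levelSet K ρ t) :=
  hK.inter (measurableSet_lt measurable_const hρ)

lemma ofReal_indicator (K : Set (Space d)) (ρ : Space d → ℝ) :
    (fun x => ENNReal.ofReal (K.indicator ρ x)) = K.indicator fun x => ENNReal.ofReal (ρ x) :=
  indicator_comp_of_zero ENNReal.ofReal_zero |>.symm

lemma levelDensity_indicator {t : ℝ} (ht : 0 < t) :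
    levelDensity (K.indicator ρ) t = (levelSet K ρ t).indicator 1 := by
  ext x
  by_cases hx : x ∈ K <;> by_cases htx : t < ρ x <;>
    simp [levelDensity, levelSet, indicator, hx, htx, ht]

lemma target_eq_normalized (hK : MeasurableSet K) :
    target K ρ = normalized (densityMeasure volume (K.indicator ρ)) := by
  rw [densityMeasure, ofReal_indicator, withDensity_indicator hK, target]

lemma ae_mem_target (hK : MeasurableSet K) : ∀ᵐ x ∂target K ρ, x ∈ K :=
  Measure.ae_smul_measure
    ((withDensity_absolutelyContinuous _ _).ae_le (ae_restrict_mem hK)) _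

lemma lintegral_ofReal_indicator_ne_top (hK : MeasurableSet K) (hρint : IntegrableOn ρ K) :
    ∫⁻ x, ENNReal.ofReal (K.indicator ρ x) ≠ ∞ := by
  rw [ofReal_indicator, lintegral_indicator hK]
  exact hρint.lintegral_lt_top.ne

instance (K : Set (Space d)) (ρ : Space d → ℝ) : IsFiniteMeasure (target K ρ) :=
  inferInstanceAs (IsFiniteMeasure (normalized _))

lemma invariant_target (hK : MeasurableSet K) {κ : Kernel (Space d) (Space d)}
    (h : κ.Invariant (densityMeasure volume (K.indicator ρ))) : κ.Invariant (target K ρ) := by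
  rw [target_eq_normalized hK]
  exact invariant_normalized h

lemma isMarkovOperator_target (hK : MeasurableSet K) {κ : Kernel (Space d) (Space d)}
    [IsSubMarkovKernel κ] (h : κ.Invariant (target K ρ)) {κ' : Space d → Measure (Space d)}
    (hκ : ∀ x ∈ K, κ x = κ' x) : IsMarkovOperator (target K ρ) κ' (markovOperator h) :=
  (isMarkovOperator_markovOperator h).congr_kernel ((ae_mem_target hK).mono hκ)

lemma covGE_target (hK : MeasurableSet K) {κ κ' : Kernel (Space d) (Space d)}
    [IsSubMarkovKernel κ] [IsSubMarkovKernel κ'] (h : κ.Invariant (target K ρ))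
    (h' : κ'.Invariant (target K ρ))
    (hle : ∀ f, Measurable f → dirichletForm (densityMeasure volume (K.indicator ρ)) κ f ≤
      dirichletForm (densityMeasure volume (K.indicator ρ)) κ' f) :
    CovGE (markovOperator h) (markovOperator h') := by
  refine covGE_of_dirichletForm_le h h' fun f hf => ?_
  rw [target_eq_normalized hK, dirichletForm_normalized, dirichletForm_normalized]
  gcongr
  exact hle f hf

lemma heightKernel_indicator_apply (hK : MeasurableSet K) (hρ : Measurable ρ) {x : Space d}
    (hx : x ∈ K) : heightKernel (K.indicator ρ) x = normalized (volume.restrict (Ioo 0 (ρ x))) := by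
  rw [heightKernel_apply (hρ.indicator hK), indicator_of_mem hx]

lemma ae_pos_heightKernel {w : Space d → ℝ} (hw : Measurable w) (x : Space d) :
    ∀ᵐ t ∂heightKernel w x, 0 < t := by
  rw [heightKernel_apply hw]
  refine Measure.ae_smul_measure ?_ _
  filter_upwards [ae_restrict_mem measurableSet_Ioo] with t ht using ht.1

lemma hitAndRunKernel_apply (hK : MeasurableSet K) (hρ : Measurable ρ) (x : Space d) :
    hitAndRunKernel (K.indicator ρ) x = hitAndRun K ρ x := by
  rw [hitAndRunKernel, mixture_apply, Kernel.const_apply, hitAndRun]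
  congr with θ : 1
  rw [Kernel.sectR_apply, chordKernel_apply measurable_id
    ((hρ.indicator hK).comp measurable_snd).ennreal_ofReal, ofReal_indicator,
    withDensity_indicator hK, restrict_chord_lineMeasure]
  rfl

lemma simpleSliceKernel_apply (hK : MeasurableSet K) (hρ : Measurable ρ) {x : Space d}
    (hx : x ∈ K) : simpleSliceKernel volume (K.indicator ρ) x = simpleSlice K ρ x := by
  rw [simpleSliceKernel, mixture_apply, simpleSlice, ← heightKernel_indicator_apply hK hρ hx]
  refine Measure.bind_congr_right ?_
  filter_upwards [ae_pos_heightKernel (hρ.indicator hK) x] with t ht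
  rw [Kernel.sectR_apply, Kernel.prodMkLeft_apply, normalizedKernel_apply,
    levelKernel_apply (hρ.indicator hK), levelDensity_indicator ht,
    withDensity_indicator_one (measurableSet_levelSet hK hρ t)]

lemma hybridSliceKernel_apply (hK : MeasurableSet K) (hρ : Measurable ρ) {x : Space d}
    (hx : x ∈ K) : hybridSliceKernel (K.indicator ρ) x = hybridSlice K ρ x := by
  rw [hybridSliceKernel, mixture_apply, hybridSlice, ← heightKernel_indicator_apply hK hρ hx,
    Kernel.prod_apply, Kernel.const_apply]
  refine Measure.bind_congr_right ?_
  filter_upwards [Measure.quasiMeasurePreserving_fst.ae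
    (ae_pos_heightKernel (hρ.indicator hK) x)] with p hp
  rw [Kernel.sectR_apply, levelChordKernel, chordKernel_apply measurable_snd
    (measurable_uncurry_levelDensity_fst (hρ.indicator hK)), levelDensity_indicator hp,
    withDensity_indicator_one (measurableSet_levelSet hK hρ p.1), restrict_chord_lineMeasure]

lemma heightKernel_Ioo {w : Space d → ℝ} (hw : Measurable w) {x y : Space d} (hx : 0 < w x) :
    heightKernel w x (Ioo 0 (w y)) = ENNReal.ofReal (min 1 (w y / w x)) := by
  rw [heightKernel_apply hw, normalized_apply, Measure.restrict_apply MeasurableSet.univ,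
    Measure.restrict_apply measurableSet_Ioo, univ_inter, Ioo_inter_Ioo]
  simp only [max_self, Real.volume_Ioo, sub_zero]
  rw [← ENNReal.ofReal_inv_of_pos hx, ← ENNReal.ofReal_mul (inv_nonneg.2 hx.le),
    mul_min_of_nonneg _ _ (inv_nonneg.2 hx.le), inv_mul_cancel₀ hx.ne', min_comm, inv_mul_eq_div]

lemma mixture_levelWalk_indicator_apply (hK : MeasurableSet K) (hρ : Measurable ρ)
    (hρpos : ∀ x ∈ K, 0 < ρ x) (hq : IsRotInvDensity q) {x : Space d} (hx : x ∈ K) :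
    mixture (heightKernel (K.indicator ρ)) (levelWalk volume (K.indicator ρ) (lazyStep q)) x =
      metropolisMove K ρ q x := by
  have hw : Measurable (K.indicator ρ) := hρ.indicator hK
  rw [mixture_levelWalk_apply hw (measurable_lazyStep hq.measurable), metropolisMove,
    ← withDensity_indicator hK]
  congr with y : 1
  by_cases hy : y ∈ K
  · have haccept : acceptance K ρ x y = min 1 (ρ y / ρ x) := indicator_of_mem (mk_mem_prod hx hy) _
    have hlazy : (lazyStep q x y : ℝ≥0∞) = ENNReal.ofReal (1 / 2 * q (y - x)) := rfl
    rw [heightKernel_Ioo hw (by simpa [hx] using hρpos x hx), indicator_of_mem hy ρ,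
      indicator_of_mem hx ρ, indicator_of_mem hy, haccept, hlazy, ← ENNReal.ofReal_mul
      (le_min zero_le_one (div_nonneg (hρpos y hy).le (hρpos x hx).le)), mul_left_comm]
  · simp [hy]

lemma metropolisKernel_apply (hK : MeasurableSet K) (hρ : Measurable ρ)
    (hρpos : ∀ x ∈ K, 0 < ρ x) (hd : 0 < d) (hq : IsRotInvDensity q) {x : Space d} (hx : x ∈ K) :
    metropolisKernel (K.indicator ρ) q x = metropolis K ρ q x := by
  have : NeZero d := ⟨hd.ne'⟩
  rw [metropolisKernel, fillKernel_apply, mixture_levelWalk_indicator_apply hK hρ hρpos hq hx,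
    metropolis]
  have hmove : metropolisMove K ρ q x ≪ volume.restrict K := withDensity_absolutelyContinuous _ _
  have huniv : (K \ {x} : Set (Space d)) =ᵐ[metropolisMove K ρ q x] univ := by
    refine hmove.ae_le ?_
    filter_upwards [ae_restrict_mem hK, measure_eq_zero_iff_ae_notMem.1 (measure_singleton x)]
      with y hyK hyx
    exact eq_true ⟨hyK, hyx⟩
  rw [measure_congr huniv]

end Target

end Samplers

theorem theorem1 (d : ℕ) (hd : 0 < d)
    (K : Set (EuclideanSpace ℝ (Fin d))) (hK : MeasurableSet K)
    (hK0 : MeasureTheory.volume K ≠ 0)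
    (ρ : EuclideanSpace ℝ (Fin d) → ℝ) (hρm : Measurable ρ) (hρpos : ∀ x ∈ K, 0 < ρ x)
    (hρint : MeasureTheory.IntegrableOn ρ K MeasureTheory.volume)
    (q : EuclideanSpace ℝ (Fin d) → ℝ) (hq : Samplers.IsRotInvDensity q) :
    ∃ M U H S : MeasureTheory.Lp ℝ 2 (Samplers.target K ρ) →L[ℝ]
        MeasureTheory.Lp ℝ 2 (Samplers.target K ρ),
      Samplers.IsMarkovOperator (Samplers.target K ρ) (Samplers.metropolis K ρ q) M ∧
      Samplers.IsMarkovOperator (Samplers.target K ρ) (Samplers.hybridSlice K ρ) U ∧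
      Samplers.IsMarkovOperator (Samplers.target K ρ) (Samplers.hitAndRun K ρ) H ∧
      Samplers.IsMarkovOperator (Samplers.target K ρ) (Samplers.simpleSlice K ρ) S ∧
      Samplers.CovGE M U ∧ Samplers.CovGE U H ∧ Samplers.CovGE U S := by
  have hw : Measurable (K.indicator ρ) := hρm.indicator hK
  have hint := Samplers.lintegral_ofReal_indicator_ne_top hK hρint
  have := hq.isSubMarkovKernel_metropolisKernel hw
  have hM := Samplers.invariant_target hK (Samplers.invariant_metropolisKernel hw hq)
  have hU := Samplers.invariant_target hK (Samplers.invariant_hybridSliceKernel hd hw hint)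
  have hH := Samplers.invariant_target hK (Samplers.invariant_hitAndRunKernel hd hw hint)
  have hS := Samplers.invariant_target hK (Samplers.invariant_simpleSliceKernel hw hint)
  refine ⟨Samplers.markovOperator hM, Samplers.markovOperator hU, Samplers.markovOperator hH,
    Samplers.markovOperator hS, ?_, ?_, ?_, ?_, ?_, ?_, ?_⟩
  · exact Samplers.isMarkovOperator_target hK hM fun _ hx =>
      Samplers.metropolisKernel_apply hK hρm hρpos hd hq hx
  · exact Samplers.isMarkovOperator_target hK hU fun _ hx =>
      Samplers.hybridSliceKernel_apply hK hρm hx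
  · exact Samplers.isMarkovOperator_target hK hH fun x _ => Samplers.hitAndRunKernel_apply hK hρm x
  · exact Samplers.isMarkovOperator_target hK hS fun _ hx =>
      Samplers.simpleSliceKernel_apply hK hρm hx
  · exact Samplers.covGE_target hK hM hU fun _ hf =>
      Samplers.dirichletForm_metropolisKernel_le hd hw hint hq hf
  · exact Samplers.covGE_target hK hU hH fun _ hf =>
      Samplers.dirichletForm_hybridSliceKernel_le_hitAndRunKernel hw hint hf
  · exact Samplers.covGE_target hK hU hS fun _ hf =>
      Samplers.dirichletForm_hybridSliceKernel_le_simpleSliceKernel hd hw hint hf
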